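/- **Setting.** There are $m$ base arms and an action space $\mathbb S$ (possibly infinite). $\mathbb D$ is a class of probability distributions on $[0,1]^m$; for $\mathcal D\in\mathbb D$ let $\boldsymbol\mu_{\mathcal D}$ be its mean vector. In round $t=1,\dots,T$ the outcome vector $X^{(t)}\sim\mathcal D_t\in\mathbb D$ is drawn independently of the past and of the action $S_t$ (the sequence $\mathcal D_1,\mathcal D_2,\dots$ is fixed in advance); a random set $\tau_t\subseteq[m]$ of arms is then triggered according to a distribution $\mathcal D^{trig}(S_t,X^{(t)})$, and the outcomes $X^{(t)}_i$, $i\in\tau_t$, are observed. Write $p_i^{\mathcal D,S}$ for the probability that $S$ triggers arm $i$ under $\mathcal D$. Whether an arm is triggered does not bias its outcome: $\mathbb E[X_i\mid i\in\tau]=\mathbb E[X_i]$ for all $\mathcal D\in\mathbb D$, $S$, $i$ with $p_i^{\mathcal D,S}>0$. The reward $R(S,X,\tau)\ge 0$ has expectation $r_S(\boldsymbol\mu)$, a function of $S$ and the mean vector $\boldsymbol\mu$ only, which is defined for all $\boldsymbol\mu\in[0,1]^m$; $\mathrm{opt}_{\boldsymbol\mu}=\sup_S r_S(\boldsymbol\mu)<\infty$.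 Assume * monotonicity: $\boldsymbol\mu\le\boldsymbol\mu'$ implies $r_S(\boldsymbol\mu)\le r_S(\boldsymbol\mu')$; * $1$-norm TPM bounded smoothness: $|r_S(\boldsymbol\mu_{\mathcal D})-r_S(\boldsymbol\mu')|\le B\sum_i p_i^{\mathcal D,S}|\mu_{\mathcal D,i}-\mu'_i|$ for all $\mathcal D\in\mathbb D$, $\boldsymbol\mu'\in[0,1]^m$, $S\in\mathbb S$; * a randomized $(\alpha,\beta)$-approximation oracle ${\sf O}$, $\alpha,\beta\in[0,1]$: for each $\boldsymbol\mu\in[0,1]^m$, $\Pr\{r_{{\sf O}(\boldsymbol\mu)}(\boldsymbol\mu)\ge\alpha\,\mathrm{opt}_{\boldsymbol\mu}\}\ge\beta$. Let $\boldsymbol\mu_t$ be the mean vector of $\mathcal D_t$, $\mathcal V=\sum_{t=2}^T\|\boldsymbol\mu_t-\boldsymbol\mu_{t-1}\|_\infty$, $\mathcal S=1+\sum_{t=2}^T\mathbb I\{\mathcal D_t\ne\mathcal D_{t-1}\}$, $K=\max_{t\le T,S}|\{i:p_i^{\mathcal D_t,S}>0\}|$, $\Delta_S^{\mathcal D}=\max\{0,\alpha\,\mathrm{opt}_{\boldsymbol\mu_{\mathcal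 D}}-r_S(\boldsymbol\mu_{\mathcal D})\}$, and $\Delta^i_{\min}=\inf\{\Delta_S^{\mathcal D_t}:t\le T,\ p_i^{\mathcal D_t,S}>0,\ \Delta_S^{\mathcal D_t}>0\}$ ($+\infty$ if there is no such pair; $c/\infty=0$, and $c/0=\infty$ for $c>0$). **Algorithm** (sliding-window CUCB with window $w$, rounded down to an integer). In round $t$ let $T_{i,t}$ and $\hat\mu_{i,t}$ be the number of observations and the empirical mean of arm $i$ in the rounds $\max\{t-w+1,1\},\dots,t-1$, put $\bar\mu_{i,t}=\min\{\hat\mu_{i,t}+\sqrt{3\ln T/(2T_{i,t})},1\}$ ($=1$ if $T_{i,t}=0$), and play $S_t={\sf O}(\bar\mu_{1,t},\dots,\bar\mu_{m,t})$. Its regret is $\mathrm{Reg}_{\alpha,\beta}=\alpha\beta\sum_{t=1}^T\mathrm{opt}_{\boldsymbol\mu_t}-\mathbb E\big[\sum_{t=1}^T r_{S_t}(\boldsymbol\mu_t)\big]$. **Theorem.** Here $\tilde{\mathcal O}(f)$ means: at most $C(1+\ln T)^k f$, with $C$ and the exponent $k$ independent of the instance except as stated. 1. With $w=\min\{\sqrt{T/\mathcal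 V},T\}$, $$\mathrm{Reg}_{\alpha,\beta}=\tilde{\mathcal O}\Big(\sum_{i\in[m]}\frac{K\sqrt{\mathcal V T}}{\Delta^i_{\min}}+\sum_{i\in[m]}\frac{K}{\Delta^i_{\min}}+mK\Big),$$ where $C,k$ depend only on $B$ and on an upper bound $G$ for the smallest gap: if some action has a positive gap in some round $t\le T$, then $\Delta^i_{\min}\le G$ is required for at least one arm $i$. 2. With $w=\min\{m^{1/3}T^{2/3}K^{-1/3}\mathcal V^{-2/3},T\}$, $$\mathrm{Reg}_{\alpha,\beta}=\tilde{\mathcal O}\big((m\mathcal V)^{1/3}(KT)^{2/3}+\sqrt{mKT}+mK\big),$$ where $C,k$ depend only on $B$. (For $\mathcal V=0$ or, in 2, $K=0$, the window is $T$.) Moreover $\mathcal V\le\mathcal S$, and both bounds also hold with $\mathcal S$ in place of $\mathcal V$, whether the replacement is made in the bound only or in the window as well. -/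

import Mathlib

open MeasureTheory ProbabilityTheory
open scoped ENNReal

namespace CMAB

/-- What happens in one round: the chosen action, the outcomes of the `m` base arms, and the set
of triggered arms. -/
abbrev Round (m : ℕ) (𝕊 : Type*) : Type _ := 𝕊 × ((Fin m → ℝ) × Set (Fin m))

/-- The mean vector of a joint distribution of the arm outcomes. -/
noncomputable def mean {m : ℕ} (D : Measure (Fin m → ℝ)) : Fin m → ℝ := fun i => ∫ x, x i ∂D

/-- Joint law of the outcomes `X ∼ D` and the triggered set `τ ∼ trig (S, X)`, as a kernel in the
action `S`. -/
noncomputable def outcomeKernel {m : ℕ} {𝕊 : Type*} [MeasurableSpace 𝕊]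
    (trig : Kernel (𝕊 × (Fin m → ℝ)) (Set (Fin m))) (D : Measure (Fin m → ℝ)) :
    Kernel 𝕊 ((Fin m → ℝ) × Set (Fin m)) :=
  Kernel.compProd (Kernel.const 𝕊 D) trig

/-- The probability `p_i^{D,S}` that the action `S` triggers the arm `i` when the outcomes have the
distribution `D`. -/
noncomputable def trigProb {m : ℕ} {𝕊 : Type*} [MeasurableSpace 𝕊]
    (trig : Kernel (𝕊 × (Fin m → ℝ)) (Set (Fin m))) (D : Measure (Fin m → ℝ)) (S : 𝕊)
    (i : Fin m) : ℝ :=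
  (outcomeKernel trig D S).real {z | i ∈ z.2}

/-- A combinatorial semi-bandit with `m` base arms, action space `𝕊` and probabilistically
triggered arms. -/
structure Problem (m : ℕ) (𝕊 : Type*) [MeasurableSpace 𝕊] where
  /-- the class of possible joint distributions of the arm outcomes -/
  envs : Set (Measure (Fin m → ℝ))
  /-- the probabilistic triggering function: the law of the triggered set given `(S, X)` -/
  trig : Kernel (𝕊 × (Fin m → ℝ)) (Set (Fin m))
  /-- the reward `R(S, X, τ)` -/
  R : 𝕊 → (Fin m → ℝ) → Set (Fin m) → ℝ
  /-- the expected reward `r_S(μ)` of an action as a function of the mean vector `μ ∈ [0,1]^m` -/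
  r : 𝕊 → (Fin m → ℝ) → ℝ
  isProb : ∀ D ∈ envs, IsProbabilityMeasure D
  support : ∀ D ∈ envs, ∀ᵐ x ∂D, x ∈ Set.Icc (0 : Fin m → ℝ) 1
  trigMarkov : IsMarkovKernel trig
  R_nonneg : ∀ S x τ, 0 ≤ R S x τ
  R_integrable : ∀ D ∈ envs, ∀ S,
    Integrable (fun z : (Fin m → ℝ) × Set (Fin m) => R S z.1 z.2) (outcomeKernel trig D S)
  /-- the expected reward depends on the distribution through its mean vector only -/
  r_eq : ∀ D ∈ envs, ∀ S, r S (mean D) = ∫ z, R S z.1 z.2 ∂(outcomeKernel trig D S)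
  r_measurable : ∀ μ ∈ Set.Icc (0 : Fin m → ℝ) 1, Measurable fun S => r S μ
  /-- the optimal expected reward is finite -/
  r_bddAbove : ∀ μ ∈ Set.Icc (0 : Fin m → ℝ) 1, BddAbove (Set.range fun S => r S μ)
  /-- whether an arm is triggered does not bias its outcome: `E[X_i | i ∈ τ] = E[X_i]` -/
  unbiased : ∀ D ∈ envs, ∀ S i,
    ∫ z, Set.indicator {z : (Fin m → ℝ) × Set (Fin m) | i ∈ z.2} (fun z => z.1 i) z
      ∂(outcomeKernel trig D S) = mean D i * trigProb trig D S i

variable {m : ℕ} {𝕊 : Type*} [MeasurableSpace 𝕊]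

/-- Monotonicity of the expected reward in the mean vector. -/
def Problem.Monotonicity (P : Problem m 𝕊) : Prop :=
  ∀ μ ∈ Set.Icc (0 : Fin m → ℝ) 1, ∀ μ' ∈ Set.Icc (0 : Fin m → ℝ) 1, μ ≤ μ' →
    ∀ S, P.r S μ ≤ P.r S μ'

/-- `1`-norm triggering-probability-modulated bounded smoothness with constant `B`. -/
def Problem.TPMSmooth (P : Problem m 𝕊) (B : ℝ) : Prop :=
  ∀ D ∈ P.envs, ∀ μ' ∈ Set.Icc (0 : Fin m → ℝ) 1, ∀ S,
    |P.r S (mean D) - P.r S μ'| ≤ B * ∑ i, trigProb P.trig D S i * |mean D i - μ' i|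

/-- The optimal expected reward for the mean vector `μ`. -/
noncomputable def Problem.opt (P : Problem m 𝕊) (μ : Fin m → ℝ) : ℝ := ⨆ S, P.r S μ

/-- A randomized offline `(α,β)`-approximation oracle: on input `μ`, its output satisfies
`r_S(μ) ≥ α · opt_μ` with probability at least `β`. -/
def Problem.IsOracle (P : Problem m 𝕊) (α β : ℝ) (O : Kernel (Fin m → ℝ) 𝕊) : Prop :=
  IsMarkovKernel O ∧ ∀ μ ∈ Set.Icc (0 : Fin m → ℝ) 1,
    ENNReal.ofReal β ≤ O μ {S | α * P.opt μ ≤ P.r S μ}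

/-! Rounds are numbered from `0` : the rounds of the time horizon `T` are `0, …, T - 1`. -/

/-- The variation `𝒱` of the mean vectors; the norm is the sup norm. -/
noncomputable def variation (D : ℕ → Measure (Fin m → ℝ)) (T : ℕ) : ℝ :=
  ∑ t ∈ Finset.range (T - 1), ‖mean (D (t + 1)) - mean (D t)‖

open Classical in
/-- The number `𝒮` of stationary segments. -/
noncomputable def switchings (D : ℕ → Measure (Fin m → ℝ)) (T : ℕ) : ℕ :=
  1 + ∑ t ∈ Finset.range (T - 1), if D (t + 1) ≠ D t then 1 else 0

/-- The maximal number `K` of arms that an action can trigger in a round of the time horizon. -/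
noncomputable def Problem.maxTrig (P : Problem m 𝕊) (D : ℕ → Measure (Fin m → ℝ)) (T : ℕ) : ℕ :=
  sSup {k | ∃ t < T, ∃ S, k = Set.ncard {i | 0 < trigProb P.trig (D t) S i}}

/-- The gap of the action `S` under the distribution `D`. -/
noncomputable def Problem.gap (P : Problem m 𝕊) (α : ℝ) (D : Measure (Fin m → ℝ)) (S : 𝕊) : ℝ :=
  max 0 (α * P.opt (mean D) - P.r S (mean D))

/-- The minimal gap of the arm `i` over the time horizon; `∞` if there is no action of positive
gap that can trigger `i`. -/
noncomputable def Problem.gapMin (P : Problem m 𝕊) (α : ℝ) (D : ℕ → Measure (Fin m → ℝ)) (T : ℕ)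
    (i : Fin m) : ℝ≥0∞ :=
  ⨅ (t : ℕ) (_ : t < T) (S : 𝕊) (_ : 0 < trigProb P.trig (D t) S i) (_ : 0 < P.gap α (D t) S),
    ENNReal.ofReal (P.gap α (D t) S)

/-! The sliding-window algorithm. -/

open Classical in
/-- Number of times the arm `i` was triggered in the rounds `s` with `n - w + 1 ≤ s ≤ n - 1`. -/
noncomputable def count (w n : ℕ) (h : Fin n → Round m 𝕊) (i : Fin m) : ℕ :=
  ∑ s : Fin n, if n + 1 ≤ (s : ℕ) + w ∧ i ∈ (h s).2.2 then 1 else 0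

open Classical in
/-- Sum of the outcomes of the arm `i` observed in the same rounds. -/
noncomputable def obsSum (w n : ℕ) (h : Fin n → Round m 𝕊) (i : Fin m) : ℝ :=
  ∑ s : Fin n, if n + 1 ≤ (s : ℕ) + w ∧ i ∈ (h s).2.2 then (h s).2.1 i else 0

/-- Upper confidence bounds in round `n` : the empirical mean over the window plus the confidence
radius, truncated at `1`; the value is `1` for an arm that was not triggered in the window. -/
noncomputable def ucb (T w n : ℕ) (h : Fin n → Round m 𝕊) : Fin m → ℝ := fun i =>
  if count w n h i = 0 then 1
  else min (obsSum w n h i / count w n h i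
    + Real.sqrt (3 * Real.log T / (2 * count w n h i))) 1

theorem measurableSet_trig (w n : ℕ) (i : Fin m) (s : Fin n) :
    MeasurableSet {h : Fin n → Round m 𝕊 | n + 1 ≤ (s : ℕ) + w ∧ i ∈ (h s).2.2} := by
  refine (MeasurableSet.const _).inter ?_
  have h1 : Measurable fun h : Fin n → Round m 𝕊 => (h s).2.2 := by fun_prop
  exact h1 (measurableSet_setOfPred.2 (measurable_set_mem i))

theorem measurable_ucb (T w n : ℕ) :
    Measurable (ucb T w n : (Fin n → Round m 𝕊) → Fin m → ℝ) := by
  classical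
  refine measurable_pi_lambda _ fun i => ?_
  have hc : Measurable fun h : Fin n → Round m 𝕊 => count w n h i := by
    unfold count
    refine Finset.measurable_sum _ fun s _ => ?_
    exact Measurable.ite (measurableSet_trig w n i s) measurable_const measurable_const
  have hs : Measurable fun h : Fin n → Round m 𝕊 => obsSum w n h i := by
    unfold obsSum
    refine Finset.measurable_sum _ fun s _ => ?_
    exact Measurable.ite (measurableSet_trig w n i s) (by fun_prop) measurable_const
  have hc' : Measurable fun h : Fin n → Round m 𝕊 => (count w n h i : ℝ) :=
    measurable_from_top.comp hc
  unfold ucb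
  refine Measurable.ite (hc (measurableSet_singleton 0)) measurable_const ?_
  fun_prop

/-- Conditional law of round `n` given the history: the oracle is applied to the upper confidence
bounds, the outcomes are drawn from `D` independently of the past and of the chosen action, and
the triggered set is drawn from the triggering function. -/
noncomputable def Problem.stepKernel (P : Problem m 𝕊) (O : Kernel (Fin m → ℝ) 𝕊)
    (T w n : ℕ) (D : Measure (Fin m → ℝ)) : Kernel (Fin n → Round m 𝕊) (Round m 𝕊) :=
  Kernel.compProd (O.comap (ucb T w n) (measurable_ucb T w n))
    (Kernel.prodMkLeft (Fin n → Round m 𝕊) (outcomeKernel P.trig D))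

/-- Law of the first `n` rounds of the sliding-window algorithm with window `w` in the environment
`D 0, D 1, …`. -/
noncomputable def Problem.law (P : Problem m 𝕊) (O : Kernel (Fin m → ℝ) 𝕊)
    (D : ℕ → Measure (Fin m → ℝ)) (T w : ℕ) : (n : ℕ) → Measure (Fin n → Round m 𝕊)
  | 0 => Measure.dirac Fin.elim0
  | n + 1 => (Measure.compProd (Problem.law P O D T w n) (P.stepKernel O T w n (D n))).map
      fun z => (Fin.snoc z.1 z.2 : Fin (n + 1) → Round m 𝕊)

/-- The `(α,β)`-approximation non-stationary regret of the sliding-window algorithm. -/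
noncomputable def Problem.regret (P : Problem m 𝕊) (α β : ℝ) (O : Kernel (Fin m → ℝ) 𝕊)
    (D : ℕ → Measure (Fin m → ℝ)) (T w : ℕ) : ℝ :=
  α * β * ∑ t ∈ Finset.range T, P.opt (mean (D t))
    - ∫ h, ∑ t : Fin T, P.r (h t).1 (mean (D t)) ∂(P.law O D T w T)

/-- The window `min {√(T/v), T}` (which is `T` for `v = 0`), rounded down. -/
noncomputable def windowDep (T : ℕ) (v : ℝ) : ℕ :=
  if v = 0 then T else ⌊min (Real.sqrt (T / v)) T⌋₊

/-- The window `min {m^{1/3} T^{2/3} K^{-1/3} v^{-2/3}, T}` (which is `T` for `v = 0` or `K = 0`),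
rounded down. -/
noncomputable def windowIndep (m T K : ℕ) (v : ℝ) : ℕ :=
  if v = 0 ∨ K = 0 then T
  else ⌊min ((m : ℝ) ^ (1 / 3 : ℝ) * (T : ℝ) ^ (2 / 3 : ℝ) * (K : ℝ) ^ (-(1 / 3) : ℝ)
    * v ^ (-(2 / 3) : ℝ)) T⌋₊

/-- `∑_i K √(v T) / Δ_i + ∑_i K / Δ_i + m K`, with values in `[0, ∞]`. -/
noncomputable def boundDep (m T K : ℕ) (v : ℝ) (Δ : Fin m → ℝ≥0∞) : ℝ≥0∞ :=
  (∑ i, ENNReal.ofReal (K * Real.sqrt (v * T)) / Δ i) + (∑ i, (K : ℝ≥0∞) / Δ i)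
    + (m : ℝ≥0∞) * (K : ℝ≥0∞)

/-- `(m v)^{1/3} (K T)^{2/3} + √(m K T) + m K`. -/
noncomputable def boundIndep (m T K : ℕ) (v : ℝ) : ℝ :=
  ((m : ℝ) * v) ^ (1 / 3 : ℝ) * ((K : ℝ) * T) ^ (2 / 3 : ℝ) + Real.sqrt (m * K * T) + m * K

/-- Standing assumptions on an instance: monotonicity, bounded smoothness with constant `B`, an
`(α,β)`-approximation oracle, and an environment that lies in the class of the problem. -/
structure Problem.Admissible (P : Problem m 𝕊) (B α β : ℝ) (O : Kernel (Fin m → ℝ) 𝕊)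
    (D : ℕ → Measure (Fin m → ℝ)) (T : ℕ) : Prop where
  α_mem : α ∈ Set.Icc (0 : ℝ) 1
  β_mem : β ∈ Set.Icc (0 : ℝ) 1
  monotone : P.Monotonicity
  smooth : P.TPMSmooth B
  oracle : P.IsOracle α β O
  env : ∀ t < T, D t ∈ P.envs

end CMAB

/-!
The expected regret of a round is controlled, given the history, by the event `A` that the oracle
succeeds: failures are paid for by the factor `β` because rewards are nonnegative. On `A` the gap of
the played action is bounded in terms of the error of the upper confidence bounds
(`Problem.gap_le`). In a changing environment these bounds are optimistic only up to the variation
`v` of the means within the window. Lowering the true means by `v` restores optimism, and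
smoothness makes this cost at most `B K v`. So, as long as the observed means are concentrated,
`gap ≤ B ∑ p_i · width_i + 2 B K v`, where `width_i ≤ 1` is twice the confidence radius.
Without concentration the gap is still at most `2 B K`, and by Hoeffding's lemma
(`Problem.lintegral_prod_exp_le_one`, `Problem.law_deviationSet_le`) the failures of concentration
cost `O(B m K)` in total. Hoeffding's lemma applies because triggering does not bias the outcomes.

Thresholds `δ_i` make the sum of the widths small. If the gap pays for them, that is,
`∑ p_i δ_i ≤ gap + e`, then `gap = 2 · gap - gap` yields
`gap ≤ ∑ p_i (2 B width_i - δ_i)⁺ + 4 B K v + e` (`Problem.gap_le_sum_excess`). The widths are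
functions of the history, so in expectation `p_i` may be replaced by the indicator that arm `i` is
triggered. Now cut time into blocks of `w` rounds. The window of a round contains the
earlier rounds of its block, so in each block the charges of arm `i` are dominated by those of
`0, 1, 2, …` observations, whose sum is `O(B² (1 + ln T) / δ_i)` (`sum_window_le`,
`sum_excess_le_excessBound`). As every change of the means lies in fewer than `w` windows, this
gives
`Problem.regret_le`:
`regret ≤ (T / w + 1) ∑ O(B² (1 + ln T) / δ_i) + 4 B K w 𝒱 + e T + 4 B K m`.

The distribution-dependent bound takes `δ_i = Δ_i / K` and `e = 0`, the distribution-independent one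
takes all `δ_i` equal to some `ε`, with `e = K ε`, and balances. Of the variation only `𝒱 ≤ v ≤ T`
is used for the parameter `v` of the window and the bound, which covers the number of switchings.
-/

namespace CMAB

/-! ### Counting observations in a sliding window -/

section Counting

open Finset

theorem sum_hits_eq (b : ℕ → Prop) [DecidablePred b] (ψ : ℕ → ℝ) (a l : ℕ) :
    ∑ t ∈ Ico a (a + l), (if b t then ψ #{s ∈ Ico a t | b s} else 0)
      = ∑ j ∈ range #{s ∈ Ico a (a + l) | b s}, ψ j := by
  induction l with
  | zero => simp
  | succ l ih =>
    rw [← add_assoc, sum_Ico_succ_top (by omega), ih, Nat.Ico_succ_right_eq_insert_Ico (by omega),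
      filter_insert]
    by_cases h : b (a + l)
    · simp only [if_pos h]
      rw [card_insert_of_notMem (by simp), sum_range_succ]
    · simp [h]

/-- Charging `ψ (number of hits in the window)` for every hit costs at most `F` per block of `w`
rounds: the window of a round contains all earlier rounds of its block, so that within a block the
charges are dominated by `ψ 0, ψ 1, …`. -/
theorem sum_window_le (b : ℕ → Prop) [DecidablePred b] {ψ : ℕ → ℝ} (hanti : Antitone ψ)
    (hpos : ∀ j, 0 ≤ ψ j) {F : ℝ} (hF : ∀ N, ∑ j ∈ range N, ψ j ≤ F) {w : ℕ} (hw : 0 < w) (T : ℕ) :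
    ∑ t ∈ range T, (if b t then ψ #{s ∈ range t | t + 1 ≤ s + w ∧ b s} else 0)
      ≤ (T / w + 1 : ℕ) * F := by
  have key : ∀ q : ℕ, ∑ t ∈ range (q * w),
      (if b t then ψ #{s ∈ range t | t + 1 ≤ s + w ∧ b s} else 0) ≤ q * F := by
    intro q
    induction q with
    | zero => simp
    | succ q ih =>
      rw [add_one_mul, range_eq_Ico, ← sum_Ico_consecutive _ (Nat.zero_le (q * w)) (by omega),
        ← range_eq_Ico]
      push_cast
      rw [add_one_mul]
      refine add_le_add ih ?_
      refine le_trans (sum_le_sum fun t ht => ?_) ((sum_hits_eq b ψ (q * w) w).trans_le (hF _))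
      rw [mem_Ico] at ht
      split_ifs
      · refine hanti (card_le_card fun s hs => ?_)
        simp only [mem_filter, mem_Ico, mem_range] at hs ⊢
        exact ⟨hs.1.2, by omega, hs.2⟩
      · exact le_rfl
  refine le_trans (sum_le_sum_of_subset_of_nonneg ?_ fun t _ _ => ?_) (key _)
  · refine range_subset_range.2 ?_
    rw [add_one_mul]
    exact (Nat.lt_div_mul_add hw).le
  · split_ifs
    exacts [hpos _, le_rfl]

theorem sum_inv_sqrt_le (N : ℕ) :
    ∑ j ∈ range N, 1 / √((j : ℝ) + 1) ≤ 2 * √(N : ℝ) := by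
  induction N with
  | zero => simp
  | succ N ih =>
    rw [sum_range_succ]
    push_cast
    have h1 : 0 < √((N : ℝ) + 1) := Real.sqrt_pos.2 (by positivity)
    have h2 := Real.sq_sqrt (show (0 : ℝ) ≤ (N : ℝ) + 1 by positivity)
    have h3 := Real.sq_sqrt (show (0 : ℝ) ≤ (N : ℝ) by positivity)
    have h4 : 1 / √((N : ℝ) + 1) ≤ 2 * √((N : ℝ) + 1) - 2 * √(N : ℝ) := by
      rw [div_le_iff₀ h1]
      nlinarith [sq_nonneg (√((N : ℝ) + 1) - √(N : ℝ))]
    linarith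

/-- Only the terms with `j + 1 < a² / δ²` are positive, and the sum of the first `n` of them is at
most `2 a √n - δ n ≤ a² / δ`. -/
theorem sum_excess_le {a δ : ℝ} (ha : 0 ≤ a) (hδ : 0 < δ) (N : ℕ) :
    ∑ j ∈ range N, max 0 (a / √((j : ℝ) + 1) - δ) ≤ a ^ 2 / δ := by
  induction N with
  | zero => simpa using by positivity
  | succ N ih =>
    by_cases h : a / √((N : ℝ) + 1) ≤ δ
    · rw [sum_range_succ, max_eq_left (by linarith)]
      linarith
    · have h1 : ∀ j ∈ range (N + 1), max 0 (a / √((j : ℝ) + 1) - δ)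
          = a * (1 / √((j : ℝ) + 1)) - δ := by
        intro j hj
        have hjN : (j : ℝ) ≤ N := by exact_mod_cast Nat.lt_succ_iff.1 (mem_range.1 hj)
        have : a / √((N : ℝ) + 1) ≤ a / √((j : ℝ) + 1) := by gcongr
        rw [max_eq_right (by linarith)]
        ring
      rw [sum_congr rfl h1, sum_sub_distrib, ← mul_sum, sum_const, card_range, nsmul_eq_mul]
      have h2 := mul_le_mul_of_nonneg_left (sum_inv_sqrt_le (N + 1)) ha
      have h3 := Real.sq_sqrt (show (0 : ℝ) ≤ ((N + 1 : ℕ) : ℝ) by positivity)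
      rw [le_div_iff₀ hδ]
      generalize √((N + 1 : ℕ) : ℝ) = s at h2 h3
      rw [← h3]
      nlinarith [sq_nonneg (a - δ * s), mul_le_mul_of_nonneg_right h2 hδ.le]

/-- Bound for the error of the upper confidence bound of an arm with `j` observations: twice the
confidence radius with `L` in place of `ln T`, truncated at `1`. -/
noncomputable def confWidth (L : ℝ) (j : ℕ) : ℝ :=
  if j = 0 then 1 else min 1 (2 * √(3 * L / (2 * j)))

theorem confWidth_le_one (L : ℝ) (j : ℕ) : confWidth L j ≤ 1 := by
  unfold confWidth
  split_ifs
  exacts [le_rfl, min_le_left _ _]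

theorem confWidth_antitone {L : ℝ} (hL : 0 ≤ L) : Antitone (confWidth L) := by
  intro i j hij
  rcases Nat.eq_zero_or_pos i with rfl | hi
  · simpa [confWidth] using confWidth_le_one L j
  · have hi' : (0 : ℝ) < i := by exact_mod_cast hi
    have hij' : (i : ℝ) ≤ j := by exact_mod_cast hij
    rw [confWidth, confWidth, if_neg hi.ne', if_neg (hi.trans_le hij).ne']
    gcongr

/-- The part of `2 B · confWidth` that exceeds the threshold `δ`. -/
noncomputable def excess (B L δ : ℝ) (j : ℕ) : ℝ := max 0 (2 * B * confWidth L j - δ)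

theorem excess_nonneg (B L δ : ℝ) (j : ℕ) : 0 ≤ excess B L δ j := le_max_left _ _

theorem excess_antitone {B L : ℝ} (hB : 0 ≤ B) (hL : 0 ≤ L) (δ : ℝ) :
    Antitone (excess B L δ) := by
  intro i j hij
  have := confWidth_antitone hL hij
  unfold excess
  gcongr

/-- A bound for the sum of `excess B L δ` over all numbers of observations. The case `2 B ≤ δ`, in
which there is no excess at all, serves the arms of infinite minimal gap. -/
noncomputable def excessBound (B L δ : ℝ) : ℝ :=
  if 2 * B ≤ δ then 0 else (4 * B ^ 2 + 24 * B ^ 2 * L) / δ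

theorem sum_excess_le_excessBound {B L δ : ℝ} (hB : 0 ≤ B) (hL : 0 ≤ L) (hδ : 0 < δ) (N : ℕ) :
    ∑ j ∈ range N, excess B L δ j ≤ excessBound B L δ := by
  unfold excessBound
  split_ifs with h
  · refine (sum_eq_zero fun j _ => max_eq_left ?_).le
    nlinarith [confWidth_le_one L j]
  · refine (sum_le_sum_of_subset_of_nonneg (range_subset_range.2 (Nat.le_succ N))
      fun j _ _ => excess_nonneg B L δ j).trans ?_
    rw [sum_range_succ', add_div, add_comm]
    refine add_le_add ?_ ?_
    · rw [excess, confWidth, if_pos rfl, le_div_iff₀ hδ]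
      rw [max_eq_right (by linarith)]
      nlinarith
    · have h1 := sum_excess_le (a := 4 * B * √(3 * L / 2)) (by positivity) hδ N
      rw [mul_pow, Real.sq_sqrt (by positivity)] at h1
      refine (sum_le_sum fun j _ => ?_).trans (h1.trans_eq (by ring))
      rw [excess, confWidth, if_neg (Nat.succ_ne_zero j)]
      refine max_le_max le_rfl (sub_le_sub_right ?_ _)
      refine (mul_le_mul_of_nonneg_left (min_le_right _ _) (by positivity)).trans_eq ?_
      rw [← div_div, Real.sqrt_div (by positivity)]
      push_cast
      ring

end Counting

/-! ### The gap of the played action -/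

section Gap

variable {m : ℕ} {𝕊 : Type*} [MeasurableSpace 𝕊]

theorem Problem.mean_mem (P : Problem m 𝕊) {D : Measure (Fin m → ℝ)} (hD : D ∈ P.envs) :
    mean D ∈ Set.Icc (0 : Fin m → ℝ) 1 := by
  have := P.isProb D hD
  have hs := P.support D hD
  have hi : ∀ i, Integrable (fun x : Fin m → ℝ => x i) D := fun i =>
    Integrable.of_mem_Icc 0 1 (measurable_pi_apply i).aemeasurable (hs.mono fun x hx => ⟨hx.1 i, hx.2 i⟩)
  refine ⟨fun i => integral_nonneg_of_ae (hs.mono fun x hx => hx.1 i), fun i => ?_⟩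
  refine (integral_mono_ae (hi i) (integrable_const 1) (hs.mono fun x hx => hx.2 i)).trans ?_
  simp

theorem Problem.isMarkovKernel_outcomeKernel (P : Problem m 𝕊) {D : Measure (Fin m → ℝ)}
    (hD : D ∈ P.envs) : IsMarkovKernel (outcomeKernel P.trig D) := by
  have := P.isProb D hD
  have := P.trigMarkov
  unfold outcomeKernel
  infer_instance

theorem trigProb_nonneg (trig : Kernel (𝕊 × (Fin m → ℝ)) (Set (Fin m)))
    (D : Measure (Fin m → ℝ)) (S : 𝕊) (i : Fin m) : 0 ≤ trigProb trig D S i :=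
  measureReal_nonneg

theorem Problem.trigProb_le_one (P : Problem m 𝕊) {D : Measure (Fin m → ℝ)}
    (hD : D ∈ P.envs) (S : 𝕊) (i : Fin m) : trigProb P.trig D S i ≤ 1 := by
  have := P.isMarkovKernel_outcomeKernel hD
  exact measureReal_le_one

theorem Problem.r_nonneg (P : Problem m 𝕊) {D : Measure (Fin m → ℝ)}
    (hD : D ∈ P.envs) (S : 𝕊) : 0 ≤ P.r S (mean D) := by
  rw [P.r_eq D hD S]
  exact integral_nonneg fun z => P.R_nonneg _ _ _

theorem Problem.r_le_opt (P : Problem m 𝕊) {μ : Fin m → ℝ} (hμ : μ ∈ Set.Icc (0 : Fin m → ℝ) 1)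
    (S : 𝕊) : P.r S μ ≤ P.opt μ :=
  le_ciSup (P.r_bddAbove μ hμ) S

theorem Problem.opt_nonneg (P : Problem m 𝕊) {D : Measure (Fin m → ℝ)}
    (hD : D ∈ P.envs) : 0 ≤ P.opt (mean D) :=
  Real.iSup_nonneg fun S => P.r_nonneg hD S

theorem Problem.gap_nonneg (P : Problem m 𝕊) (α : ℝ) (D : Measure (Fin m → ℝ)) (S : 𝕊) :
    0 ≤ P.gap α D S :=
  le_max_left _ _

theorem Problem.ncard_le_maxTrig (P : Problem m 𝕊) (D : ℕ → Measure (Fin m → ℝ)) {T t : ℕ}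
    (ht : t < T) (S : 𝕊) : Set.ncard {i | 0 < trigProb P.trig (D t) S i} ≤ P.maxTrig D T := by
  refine le_csSup ⟨m, ?_⟩ ⟨t, ht, S, rfl⟩
  rintro k ⟨t, -, S, rfl⟩
  simpa using Set.ncard_le_card {i | 0 < trigProb P.trig (D t) S i}

theorem Problem.maxTrig_le (P : Problem m 𝕊) (D : ℕ → Measure (Fin m → ℝ)) (T : ℕ) :
    P.maxTrig D T ≤ m := by
  refine csSup_le' ?_
  rintro k ⟨t, -, S, rfl⟩
  simpa using Set.ncard_le_card {i | 0 < trigProb P.trig (D t) S i}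

theorem Problem.sum_trigProb_le (P : Problem m 𝕊) {D : ℕ → Measure (Fin m → ℝ)} {T t : ℕ}
    (ht : t < T) (hD : D t ∈ P.envs) (S : 𝕊) :
    ∑ i, trigProb P.trig (D t) S i ≤ P.maxTrig D T := by
  classical
  refine le_trans ?_ (Nat.cast_le.2 (P.ncard_le_maxTrig D ht S))
  rw [Set.ncard_eq_toFinset_card', Finset.cast_card]
  rw [← Finset.sum_subset (Finset.subset_univ _) (f := fun i => trigProb P.trig (D t) S i)]
  · exact Finset.sum_le_sum fun i _ => P.trigProb_le_one hD S i
  · intro i _ hi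
    simp only [Set.mem_toFinset, Set.mem_ofPred_eq, not_lt] at hi
    exact le_antisymm hi (trigProb_nonneg _ _ _ _)

/-- The gap of an action that the oracle may play for the optimistic mean vector `u`. Optimism may
fail by `v`; lowering the true means by `v` restores it, and smoothness, applied to all actions,
bounds the effect on the optimal reward by `B K v`. -/
theorem Problem.gap_le (P : Problem m 𝕊) {B α K v : ℝ} (hB : 0 ≤ B)
    (hα : α ∈ Set.Icc (0 : ℝ) 1) (hmono : P.Monotonicity) (hsm : P.TPMSmooth B)
    {D : Measure (Fin m → ℝ)} (hD : D ∈ P.envs)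
    (hK : ∀ S, ∑ i, trigProb P.trig D S i ≤ K) {u : Fin m → ℝ}
    (hu : u ∈ Set.Icc (0 : Fin m → ℝ) 1) (hv : 0 ≤ v) (huv : ∀ i, mean D i - v ≤ u i) {S : 𝕊}
    (hS : α * P.opt u ≤ P.r S u) :
    P.gap α D S ≤ B * ∑ i, trigProb P.trig D S i * |mean D i - u i| + B * K * v := by
  have hμ := P.mean_mem hD
  have hp := fun S i => trigProb_nonneg P.trig D S i
  have hK0 : 0 ≤ K := (Finset.sum_nonneg fun i _ => hp S i).trans (hK S)
  have hsum : 0 ≤ ∑ i, trigProb P.trig D S i * |mean D i - u i| :=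
    Finset.sum_nonneg fun i _ => mul_nonneg (hp S i) (abs_nonneg _)
  have : Nonempty 𝕊 := ⟨S⟩
  have hopt : P.opt (mean D) ≤ P.opt u + B * K * v := by
    refine ciSup_le fun S' => ?_
    set μ' : Fin m → ℝ := fun i => max (mean D i - v) 0 with hμ'
    have hμ'mem : μ' ∈ Set.Icc (0 : Fin m → ℝ) 1 :=
      ⟨fun i => le_max_right _ _, fun i =>
        max_le (by have := hμ.2 i; simp only [Pi.one_apply] at this ⊢; linarith) zero_le_one⟩
    have h1 := hmono μ' hμ'mem u hu (fun i => max_le (huv i) (hu.1 i)) S'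
    have h2 := (le_abs_self _).trans (hsm D hD μ' hμ'mem S')
    have h3 : ∑ i, trigProb P.trig D S' i * |mean D i - μ' i| ≤ K * v := by
      refine le_trans ?_ (mul_le_mul_of_nonneg_right (hK S') hv)
      rw [Finset.sum_mul]
      refine Finset.sum_le_sum fun i _ => mul_le_mul_of_nonneg_left ?_ (hp S' i)
      have h0 : 0 ≤ mean D i := hμ.1 i
      simp only [hμ']
      rw [abs_le]
      rcases max_cases (mean D i - v) 0 with ⟨h, _⟩ | ⟨h, _⟩ <;> rw [h] <;> constructor <;> linarith
    have h4 := mul_le_mul_of_nonneg_left h3 hB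
    have h5 := P.r_le_opt hu S'
    linarith
  have h2 := (neg_le_abs _).trans (hsm D hD u hu S)
  have h3 : 0 ≤ B * K * v := by positivity
  refine max_le (by positivity) ?_
  have h4 := mul_le_mul_of_nonneg_left hopt hα.1
  have h5 : α * (B * K * v) ≤ B * K * v := mul_le_of_le_one_left h3 hα.2
  linarith

/-- Without any information on `u`, optimism fails by at most `1`. -/
theorem Problem.gap_le_two_mul (P : Problem m 𝕊) {B α K : ℝ} (hB : 0 ≤ B)
    (hα : α ∈ Set.Icc (0 : ℝ) 1) (hmono : P.Monotonicity) (hsm : P.TPMSmooth B)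
    {D : Measure (Fin m → ℝ)} (hD : D ∈ P.envs)
    (hK : ∀ S, ∑ i, trigProb P.trig D S i ≤ K) {u : Fin m → ℝ}
    (hu : u ∈ Set.Icc (0 : Fin m → ℝ) 1) {S : 𝕊} (hS : α * P.opt u ≤ P.r S u) :
    P.gap α D S ≤ 2 * B * K := by
  have hμ := P.mean_mem hD
  have hb : ∀ i, 0 ≤ mean D i ∧ mean D i ≤ 1 ∧ 0 ≤ u i ∧ u i ≤ 1 := fun i =>
    ⟨hμ.1 i, hμ.2 i, hu.1 i, hu.2 i⟩
  refine (P.gap_le hB hα hmono hsm hD hK hu zero_le_one (fun i => ?_) hS).trans ?_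
  · linarith [hb i]
  · have : ∑ i, trigProb P.trig D S i * |mean D i - u i| ≤ K := by
      refine le_trans (Finset.sum_le_sum fun i _ => ?_) (hK S)
      refine mul_le_of_le_one_right (trigProb_nonneg _ _ _ _) ?_
      obtain ⟨h1, h2, h3, h4⟩ := hb i
      rw [abs_le]
      constructor <;> linarith
    nlinarith

/-- The gap of the played action, charged to the arms. A threshold `δ i` can be subtracted from
the charge of each arm if the gap pays for it up to a slack `e`, because
`gap = 2 · gap - gap`. -/
theorem Problem.gap_le_sum_excess (P : Problem m 𝕊) {B α K v L e : ℝ} (hB : 0 ≤ B)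
    (hα : α ∈ Set.Icc (0 : ℝ) 1) (hmono : P.Monotonicity) (hsm : P.TPMSmooth B)
    {D : Measure (Fin m → ℝ)} (hD : D ∈ P.envs)
    (hK : ∀ S, ∑ i, trigProb P.trig D S i ≤ K) (he : 0 ≤ e) {δ : Fin m → ℝ}
    {u : Fin m → ℝ} {N : Fin m → ℕ}
    (hu : u ∈ Set.Icc (0 : Fin m → ℝ) 1) (hv : 0 ≤ v) (huv : ∀ i, mean D i - v ≤ u i)
    (huN : ∀ i, |mean D i - u i| ≤ confWidth L (N i) + v) {S : 𝕊}
    (hδ : 0 < P.gap α D S → ∑ i, trigProb P.trig D S i * δ i ≤ P.gap α D S + e)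
    (hS : α * P.opt u ≤ P.r S u) :
    P.gap α D S ≤ ∑ i, trigProb P.trig D S i * excess B L (δ i) (N i) + (4 * B * K * v + e) := by
  have hp := fun S i => trigProb_nonneg P.trig D S i
  have hK0 : 0 ≤ K := (Finset.sum_nonneg fun i _ => hp S i).trans (hK S)
  have hsum : 0 ≤ ∑ i, trigProb P.trig D S i * excess B L (δ i) (N i) :=
    Finset.sum_nonneg fun i _ => mul_nonneg (hp S i) (excess_nonneg _ _ _ _)
  rcases (P.gap_nonneg α D S).eq_or_lt with h0 | h0
  · rw [← h0]
    positivity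
  have h1 := P.gap_le hB hα hmono hsm hD hK hu hv huv hS
  have h2 := hδ h0
  have h3 : ∑ i, trigProb P.trig D S i * |mean D i - u i|
      ≤ ∑ i, trigProb P.trig D S i * confWidth L (N i) + K * v := by
    refine le_trans ?_ (add_le_add_right (mul_le_mul_of_nonneg_right (hK S) hv) _)
    rw [Finset.sum_mul, ← Finset.sum_add_distrib]
    refine Finset.sum_le_sum fun i _ => ?_
    rw [← mul_add]
    exact mul_le_mul_of_nonneg_left (huN i) (hp S i)
  have h4 : 2 * B * ∑ i, trigProb P.trig D S i * confWidth L (N i)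
      - ∑ i, trigProb P.trig D S i * δ i
      ≤ ∑ i, trigProb P.trig D S i * excess B L (δ i) (N i) := by
    rw [Finset.mul_sum, ← Finset.sum_sub_distrib]
    refine Finset.sum_le_sum fun i _ => ?_
    refine (Eq.le ?_).trans (mul_le_mul_of_nonneg_left (le_max_right _ _) (hp S i))
    ring
  have h5 := mul_le_mul_of_nonneg_left h3 hB
  linarith

end Gap

/-! ### The law of the algorithm -/

section Law

variable {m : ℕ} {𝕊 : Type*} [MeasurableSpace 𝕊]

theorem measurableSet_mem_trig (i : Fin m) :
    MeasurableSet {z : (Fin m → ℝ) × Set (Fin m) | i ∈ z.2} :=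
  measurable_snd (measurableSet_setOfPred.2 (measurable_set_mem i))

theorem Problem.isMarkovKernel_stepKernel (P : Problem m 𝕊) (O : Kernel (Fin m → ℝ) 𝕊)
    [IsMarkovKernel O] (T w n : ℕ) {D : Measure (Fin m → ℝ)} (hD : D ∈ P.envs) :
    IsMarkovKernel (P.stepKernel O T w n D) := by
  have := P.isMarkovKernel_outcomeKernel hD
  unfold Problem.stepKernel
  infer_instance

theorem Problem.lintegral_stepKernel (P : Problem m 𝕊) (O : Kernel (Fin m → ℝ) 𝕊)
    [IsMarkovKernel O] (T w n : ℕ) {D : Measure (Fin m → ℝ)} (hD : D ∈ P.envs)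
    (h : Fin n → Round m 𝕊) {f : Round m 𝕊 → ℝ≥0∞} (hf : Measurable f) :
    ∫⁻ z, f z ∂(P.stepKernel O T w n D h)
      = ∫⁻ S, ∫⁻ y, f (S, y) ∂(outcomeKernel P.trig D S) ∂(O (ucb T w n h)) := by
  have := P.isMarkovKernel_outcomeKernel hD
  unfold Problem.stepKernel
  rw [Kernel.lintegral_compProd _ _ _ hf]
  rfl

theorem measurable_snoc (n : ℕ) :
    Measurable fun z : (Fin n → Round m 𝕊) × Round m 𝕊 =>
      (Fin.snoc z.1 z.2 : Fin (n + 1) → Round m 𝕊) := by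
  refine measurable_pi_lambda _ fun i => ?_
  induction i using Fin.lastCases with
  | last => simpa using measurable_snd
  | cast i =>
    simp only [Fin.snoc_castSucc]
    exact (measurable_pi_apply i).comp measurable_fst

theorem Problem.isProbabilityMeasure_law (P : Problem m 𝕊) (O : Kernel (Fin m → ℝ) 𝕊)
    [IsMarkovKernel O] {D : ℕ → Measure (Fin m → ℝ)} (T w : ℕ) {n : ℕ}
    (hD : ∀ t < n, D t ∈ P.envs) : IsProbabilityMeasure (P.law O D T w n) := by
  induction n with
  | zero => unfold Problem.law; infer_instance
  | succ n ih =>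
    have := ih fun t ht => hD t (ht.trans n.lt_succ_self)
    have := P.isMarkovKernel_stepKernel O T w n (hD n n.lt_succ_self)
    unfold Problem.law
    exact Measure.isProbabilityMeasure_map (measurable_snoc n).aemeasurable

theorem Problem.lintegral_law_succ (P : Problem m 𝕊) (O : Kernel (Fin m → ℝ) 𝕊)
    [IsMarkovKernel O] {D : ℕ → Measure (Fin m → ℝ)} (T w : ℕ) {n : ℕ}
    (hD : ∀ t < n + 1, D t ∈ P.envs) {f : (Fin (n + 1) → Round m 𝕊) → ℝ≥0∞}
    (hf : Measurable f) :
    ∫⁻ h, f h ∂(P.law O D T w (n + 1))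
      = ∫⁻ h, ∫⁻ z, f (Fin.snoc h z) ∂(P.stepKernel O T w n (D n) h) ∂(P.law O D T w n) := by
  have := P.isProbabilityMeasure_law O T w fun t ht => hD t (ht.trans n.lt_succ_self)
  have := P.isMarkovKernel_stepKernel O T w n (hD n n.lt_succ_self)
  rw [Problem.law, lintegral_map hf (measurable_snoc n)]
  exact Measure.lintegral_compProd (hf.comp (measurable_snoc n))

theorem Problem.ae_outcomeKernel (P : Problem m 𝕊) {D : Measure (Fin m → ℝ)} (hD : D ∈ P.envs)
    (S : 𝕊) : ∀ᵐ z ∂(outcomeKernel P.trig D S), z.1 ∈ Set.Icc (0 : Fin m → ℝ) 1 := by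
  have := P.isProb D hD
  have := P.trigMarkov
  unfold outcomeKernel
  rw [Kernel.ae_compProd_iff (measurable_fst measurableSet_Icc)]
  filter_upwards [show ∀ᵐ x ∂(Kernel.const 𝕊 D S), x ∈ Set.Icc (0 : Fin m → ℝ) 1 from
    P.support D hD] with x hx
  exact Filter.Eventually.of_forall fun _ => hx

theorem Problem.ae_law (P : Problem m 𝕊) (O : Kernel (Fin m → ℝ) 𝕊)
    [IsMarkovKernel O] {D : ℕ → Measure (Fin m → ℝ)} (T w : ℕ) {n : ℕ}
    (hD : ∀ t < n, D t ∈ P.envs) :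
    ∀ᵐ h ∂(P.law O D T w n), ∀ s, (h s).2.1 ∈ Set.Icc (0 : Fin m → ℝ) 1 := by
  induction n with
  | zero => exact Filter.Eventually.of_forall fun h s => s.elim0
  | succ n ih =>
    have hD' : ∀ t < n, D t ∈ P.envs := fun t ht => hD t (ht.trans n.lt_succ_self)
    have hDn := hD n n.lt_succ_self
    have := P.isProbabilityMeasure_law O T w hD'
    have := P.isMarkovKernel_stepKernel O T w n hDn
    have := P.isMarkovKernel_outcomeKernel hDn
    have hround : MeasurableSet {z : Round m 𝕊 | z.2.1 ∈ Set.Icc (0 : Fin m → ℝ) 1} :=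
      (measurable_fst.comp measurable_snd) measurableSet_Icc
    have hset : MeasurableSet {h : Fin (n + 1) → Round m 𝕊 |
        ∀ s, (h s).2.1 ∈ Set.Icc (0 : Fin m → ℝ) 1} := by
      rw [Set.ofPred_forall]
      exact MeasurableSet.iInter fun s => hround.preimage (measurable_pi_apply s)
    rw [Problem.law, ae_map_iff (measurable_snoc n).aemeasurable hset]
    refine (Measure.ae_compProd_iff (hset.preimage (measurable_snoc n))).2 ?_
    filter_upwards [ih hD'] with h hh
    unfold Problem.stepKernel
    have : ∀ᵐ z ∂((O.comap (ucb T w n) (measurable_ucb T w n)).compProd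
        (Kernel.prodMkLeft (Fin n → Round m 𝕊) (outcomeKernel P.trig (D n)))) h,
        z.2.1 ∈ Set.Icc (0 : Fin m → ℝ) 1 := by
      rw [Kernel.ae_compProd_iff hround]
      exact Filter.Eventually.of_forall fun S => P.ae_outcomeKernel hDn S
    filter_upwards [this] with z hz s
    induction s using Fin.lastCases with
    | last => simpa using hz
    | cast s => simpa using hh s

end Law

/-! ### Concentration of the observed means -/

section Concentration

variable {m : ℕ} {𝕊 : Type*} [MeasurableSpace 𝕊]

open Classical in
/-- Hoeffding's lemma for one round: conditionally on the arm being triggered its outcome still has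
the mean `mean D i`, whatever the action is. -/
theorem Problem.lintegral_exp_outcomeKernel_le_one (P : Problem m 𝕊) {D : Measure (Fin m → ℝ)}
    (hD : D ∈ P.envs) (S : 𝕊) (i : Fin m) (l : ℝ) :
    ∫⁻ z, (if i ∈ z.2 then ENNReal.ofReal (Real.exp (l * (z.1 i - mean D i) - l ^ 2 / 8)) else 1)
      ∂(outcomeKernel P.trig D S) ≤ 1 := by
  have := P.isMarkovKernel_outcomeKernel hD
  set ν := outcomeKernel P.trig D S with hν
  set A := {z : (Fin m → ℝ) × Set (Fin m) | i ∈ z.2} with hA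
  have hAm : MeasurableSet A := measurableSet_mem_trig i
  have hX : Measurable fun z : (Fin m → ℝ) × Set (Fin m) => z.1 i - mean D i :=
    ((measurable_pi_apply i).comp measurable_fst).sub_const _
  set f : (Fin m → ℝ) × Set (Fin m) → ℝ≥0∞ := fun z =>
    ENNReal.ofReal (Real.exp (l * (z.1 i - mean D i) - l ^ 2 / 8)) with hf
  have hfm : Measurable f := (((hX.const_mul l).sub_const _).exp).ennreal_ofReal
  have hsplit : ∫⁻ z, (if i ∈ z.2 then f z else 1) ∂ν = ∫⁻ z in A, f z ∂ν + ν Aᶜ := by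
    rw [← lintegral_add_compl _ hAm]
    congr 1
    · exact setLIntegral_congr_fun hAm fun z hz => if_pos hz
    · have : ∫⁻ z in Aᶜ, (if i ∈ z.2 then f z else 1) ∂ν = ∫⁻ _ in Aᶜ, 1 ∂ν :=
        setLIntegral_congr_fun hAm.compl fun z hz => if_neg hz
      rw [this, setLIntegral_one]
  change ∫⁻ z, (if i ∈ z.2 then f z else 1) ∂ν ≤ 1
  rw [hsplit]
  suffices h : ∫⁻ z in A, f z ∂ν ≤ ν A by
    refine (add_le_add_left h _).trans ?_
    rw [measure_add_measure_compl hAm, measure_univ]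
  by_cases h0 : ν A = 0
  · rw [setLIntegral_measure_zero _ _ h0]
    exact zero_le
  have := cond_isProbabilityMeasure (μ := ν) h0
  have hae : ∀ᵐ z ∂ν[|A], z.1 i - mean D i ∈ Set.Icc (0 - mean D i) (1 - mean D i) := by
    refine cond_absolutelyContinuous.ae_le ?_
    filter_upwards [P.ae_outcomeKernel hD S] with z hz
    exact ⟨sub_le_sub_right (hz.1 i) _, sub_le_sub_right (hz.2 i) _⟩
  have hint : IntegrableOn (fun z : (Fin m → ℝ) × Set (Fin m) => z.1 i) A ν := by
    refine (Integrable.of_mem_Icc 0 1 ((measurable_pi_apply i).comp measurable_fst).aemeasurable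
      ?_).integrableOn
    filter_upwards [P.ae_outcomeKernel hD S] with z hz
    exact ⟨hz.1 i, hz.2 i⟩
  have hzero : ∫ z, (z.1 i - mean D i) ∂ν[|A] = 0 := by
    rw [ProbabilityTheory.cond, integral_smul_measure]
    have h1 := P.unbiased D hD S i
    rw [integral_indicator hAm] at h1
    rw [integral_sub hint (integrable_const _), h1]
    simp only [integral_const, smul_eq_mul, measureReal_restrict_apply_univ]
    rw [trigProb, ← hν, ← hA]
    ring
  have hsub := hasSubgaussianMGF_of_mem_Icc_of_integral_eq_zero hX.aemeasurable hae hzero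
  have hmgf : ∫⁻ z, f z ∂ν[|A] ≤ 1 := by
    have h1 := hsub.mgf_le l
    have h2 : ∫⁻ z, f z ∂ν[|A]
        = ENNReal.ofReal (∫ z, Real.exp (l * (z.1 i - mean D i)) * Real.exp (-(l ^ 2 / 8))
            ∂ν[|A]) := by
      rw [ofReal_integral_eq_lintegral_ofReal ((hsub.integrable_exp_mul l).mul_const _)
        (Filter.Eventually.of_forall fun z => by positivity)]
      simp only [hf, ← Real.exp_add, sub_eq_add_neg]
    rw [h2, integral_mul_const]
    refine ENNReal.ofReal_le_one.2 ?_
    have h3 : Real.exp (l ^ 2 / 8) * Real.exp (-(l ^ 2 / 8)) = 1 := by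
      rw [← Real.exp_add]
      simp
    rw [← h3]
    refine mul_le_mul_of_nonneg_right (h1.trans_eq ?_) (Real.exp_pos _).le
    simp
    ring
  rw [ProbabilityTheory.cond, lintegral_smul_measure, smul_eq_mul] at hmgf
  calc ∫⁻ z in A, f z ∂ν = ν A * ((ν A)⁻¹ * ∫⁻ z in A, f z ∂ν) := by
        rw [← mul_assoc, ENNReal.mul_inv_cancel h0 (measure_ne_top _ _), one_mul]
    _ ≤ ν A * 1 := by gcongr
    _ = ν A := mul_one _

theorem measurableSet_mem_trig_apply {n : ℕ} (p : Prop) (i : Fin m) (s : Fin n) :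
    MeasurableSet {h : Fin n → Round m 𝕊 | p ∧ i ∈ (h s).2.2} := by
  refine (MeasurableSet.const _).inter ?_
  have h1 : Measurable fun h : Fin n → Round m 𝕊 => (h s).2 := by fun_prop
  exact (measurableSet_mem_trig i).preimage h1

open Classical in
/-- The exponential supermartingale of an arm, restricted to the rounds in `c`. -/
theorem Problem.lintegral_prod_exp_le_one (P : Problem m 𝕊) (O : Kernel (Fin m → ℝ) 𝕊)
    [IsMarkovKernel O] {D : ℕ → Measure (Fin m → ℝ)} (T w : ℕ) {n : ℕ}
    (hD : ∀ t < n, D t ∈ P.envs) (c : ℕ → Prop) (i : Fin m) (l : ℝ) :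
    ∫⁻ h, ∏ s : Fin n, (if c s ∧ i ∈ (h s).2.2 then
      ENNReal.ofReal (Real.exp (l * ((h s).2.1 i - mean (D s) i) - l ^ 2 / 8)) else 1)
      ∂(P.law O D T w n) ≤ 1 := by
  have hmeas : ∀ n : ℕ, Measurable fun h : Fin n → Round m 𝕊 =>
      ∏ s : Fin n, (if c s ∧ i ∈ (h s).2.2 then
        ENNReal.ofReal (Real.exp (l * ((h s).2.1 i - mean (D s) i) - l ^ 2 / 8)) else 1) := by
    intro n
    refine Finset.measurable_prod _ fun s _ => ?_
    exact Measurable.ite (measurableSet_mem_trig_apply _ i s) (by fun_prop) measurable_const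
  induction n with
  | zero => simp [Problem.law]
  | succ n ih =>
    have hD' : ∀ t < n, D t ∈ P.envs := fun t ht => hD t (ht.trans n.lt_succ_self)
    have hDn := hD n n.lt_succ_self
    have := P.isMarkovKernel_stepKernel O T w n hDn
    rw [P.lintegral_law_succ O T w hD (hmeas _)]
    refine (lintegral_mono fun h => ?_).trans (ih hD')
    simp only [Fin.prod_univ_castSucc, Fin.snoc_castSucc, Fin.snoc_last, Fin.val_castSucc,
      Fin.val_last]
    have hg : Measurable fun z : Round m 𝕊 => if c n ∧ i ∈ z.2.2 then
        ENNReal.ofReal (Real.exp (l * (z.2.1 i - mean (D n) i) - l ^ 2 / 8)) else 1 := by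
      refine Measurable.ite ?_ (by fun_prop) measurable_const
      exact (MeasurableSet.const _).inter ((measurableSet_mem_trig i).preimage measurable_snd)
    rw [lintegral_const_mul _ hg]
    refine mul_le_of_le_one_right zero_le ?_
    by_cases hc : c n
    · rw [P.lintegral_stepKernel O T w n hDn h hg]
      simp only [hc, true_and]
      refine (lintegral_mono fun S => P.lintegral_exp_outcomeKernel_le_one hDn S i l).trans ?_
      simp
    · simp [hc]

open Classical in
/-- The sum of the current means of the arm `i` over the rounds in which it was observed in the
window. -/
noncomputable def meanSum (D : ℕ → Measure (Fin m → ℝ)) (w n : ℕ) (h : Fin n → Round m 𝕊)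
    (i : Fin m) : ℝ :=
  ∑ s : Fin n, if n + 1 ≤ (s : ℕ) + w ∧ i ∈ (h s).2.2 then mean (D s) i else 0

/-- Chernoff bound for a fixed number `j` of observations; `σ = ±1` selects the tail. -/
theorem Problem.law_deviation_le (P : Problem m 𝕊) (O : Kernel (Fin m → ℝ) 𝕊)
    [IsMarkovKernel O] {D : ℕ → Measure (Fin m → ℝ)} (T w : ℕ) {n : ℕ}
    (hD : ∀ t < n, D t ∈ P.envs) (i : Fin m) {L σ : ℝ} (hL : 0 ≤ L) (hσ : σ ^ 2 = 1) {j : ℕ}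
    (hj : 0 < j) :
    P.law O D T w n {h | count w n h i = j ∧
        √(3 * L * j / 2) < σ * (obsSum w n h i - meanSum D w n h i)}
      ≤ ENNReal.ofReal (Real.exp (-(3 * L))) := by
  classical
  have hj' : (0 : ℝ) < j := by exact_mod_cast hj
  set a := √(3 * L * j / 2) with ha
  have ha2 : a ^ 2 = 3 * L * j / 2 := Real.sq_sqrt (by positivity)
  have ha0 : 0 ≤ a := Real.sqrt_nonneg _
  -- this `l` maximizes the exponent `l a - l² j / 8`
  set l := σ * (4 * a / j) with hl
  set W : (Fin n → Round m 𝕊) → ℝ≥0∞ := fun h =>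
    ∏ s : Fin n, (if n + 1 ≤ (s : ℕ) + w ∧ i ∈ (h s).2.2 then
      ENNReal.ofReal (Real.exp (l * ((h s).2.1 i - mean (D s) i) - l ^ 2 / 8)) else 1) with hW
  have hWm : Measurable W := by
    refine Finset.measurable_prod _ fun s _ => ?_
    exact Measurable.ite (measurableSet_mem_trig_apply _ i s) (by fun_prop) measurable_const
  have hWexp : ∀ h, W h = ENNReal.ofReal (Real.exp
      (l * (obsSum w n h i - meanSum D w n h i) - l ^ 2 / 8 * count w n h i)) := by
    intro h
    have hsum : l * (obsSum w n h i - meanSum D w n h i) - l ^ 2 / 8 * count w n h i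
        = ∑ s : Fin n, (if n + 1 ≤ (s : ℕ) + w ∧ i ∈ (h s).2.2 then
          l * ((h s).2.1 i - mean (D s) i) - l ^ 2 / 8 else 0) := by
      unfold obsSum meanSum count
      push_cast
      rw [← Finset.sum_sub_distrib, Finset.mul_sum, Finset.mul_sum, ← Finset.sum_sub_distrib]
      refine Finset.sum_congr rfl fun s _ => ?_
      split_ifs <;> ring
    rw [hsum, Real.exp_sum, ENNReal.ofReal_prod_of_nonneg fun _ _ => (Real.exp_pos _).le]
    refine Finset.prod_congr rfl fun s _ => ?_
    split_ifs <;> simp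
  have hmarkov := mul_meas_ge_le_lintegral (μ := P.law O D T w n) hWm
    (ENNReal.ofReal (Real.exp (3 * L)))
  have hle : ∫⁻ h, W h ∂(P.law O D T w n) ≤ 1 := by
    convert P.lintegral_prod_exp_le_one O T w hD (fun s => n + 1 ≤ s + w) i l
  have hone := hmarkov.trans hle
  rw [Real.exp_neg, ENNReal.ofReal_inv_of_pos (Real.exp_pos _)]
  refine le_trans (measure_mono ?_) (ENNReal.le_inv_iff_mul_le.2 (by rwa [mul_comm] at hone))
  rintro h ⟨hcount, hdev⟩
  change ENNReal.ofReal (Real.exp (3 * L)) ≤ W h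
  rw [hWexp h, hcount]
  refine ENNReal.ofReal_le_ofReal (Real.exp_le_exp.2 ?_)
  have h1 : l * (obsSum w n h i - meanSum D w n h i)
      = 4 * a / j * (σ * (obsSum w n h i - meanSum D w n h i)) := by
    rw [hl]
    ring
  have h2 : l ^ 2 / 8 * j = 2 * a ^ 2 / j := by
    rw [hl, mul_pow, hσ]
    field_simp
    ring
  have h3 : 4 * a / j * a ≤ 4 * a / j * (σ * (obsSum w n h i - meanSum D w n h i)) := by
    gcongr
  have h4 : 4 * a / j * a - 2 * a ^ 2 / j = 3 * L := by
    have : 4 * a / j * a - 2 * a ^ 2 / j = 2 * a ^ 2 / j := by ring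
    rw [this, ha2]
    field_simp
  rw [h1, h2]
  linarith

/-- The histories for which the observed mean of some arm is far from the average of the means at
the times of observation. -/
def deviationSet (D : ℕ → Measure (Fin m → ℝ)) (L : ℝ) (w n : ℕ) : Set (Fin n → Round m 𝕊) :=
  {h | ∃ i, √(3 * L * count w n h i / 2) < |obsSum w n h i - meanSum D w n h i|}

theorem count_le {𝕊 : Type*} (w n : ℕ) (h : Fin n → Round m 𝕊) (i : Fin m) : count w n h i ≤ n := by
  unfold count
  refine (Finset.sum_le_sum (g := fun _ => 1) fun s _ => ?_).trans (by simp)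
  split_ifs <;> simp

theorem not_trig_of_count_eq_zero {𝕊 : Type*} {w n : ℕ} {h : Fin n → Round m 𝕊} {i : Fin m}
    (h0 : count w n h i = 0) (s : Fin n) : ¬ (n + 1 ≤ (s : ℕ) + w ∧ i ∈ (h s).2.2) := by
  intro hs
  simp only [count, Finset.sum_eq_zero_iff, Finset.mem_univ, true_implies] at h0
  simpa [hs] using h0 s

theorem Problem.law_deviationSet_le (P : Problem m 𝕊) (O : Kernel (Fin m → ℝ) 𝕊)
    [IsMarkovKernel O] {D : ℕ → Measure (Fin m → ℝ)} (T w : ℕ) {n : ℕ}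
    (hD : ∀ t < n, D t ∈ P.envs) {L : ℝ} (hL : 0 ≤ L) :
    P.law O D T w n (deviationSet D L w n)
      ≤ ENNReal.ofReal (2 * m * n * Real.exp (-(3 * L))) := by
  set E : ℝ → Fin m → ℕ → Set (Fin n → Round m 𝕊) := fun σ i j =>
    {h | count w n h i = j ∧ √(3 * L * j / 2) < σ * (obsSum w n h i - meanSum D w n h i)} with hE
  have hsub : (deviationSet D L w n : Set (Fin n → Round m 𝕊))
      ⊆ ⋃ i ∈ (Finset.univ : Finset (Fin m)), ⋃ j ∈ Finset.Icc 1 n, (E 1 i j ∪ E (-1) i j) := by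
    rintro h ⟨i, hi⟩
    have hpos : count w n h i ≠ 0 := by
      intro h0
      have : obsSum w n h i - meanSum D w n h i = 0 := by
        simp only [obsSum, meanSum, not_trig_of_count_eq_zero h0]
        simp
      rw [this, h0] at hi
      simp at hi
    simp only [Set.mem_iUnion]
    refine ⟨i, Finset.mem_univ _, count w n h i,
      Finset.mem_Icc.2 ⟨Nat.one_le_iff_ne_zero.2 hpos, count_le w n h i⟩, ?_⟩
    rcases lt_abs.1 hi with h1 | h1
    · exact Or.inl ⟨rfl, by simpa using h1⟩
    · exact Or.inr ⟨rfl, by simpa using h1⟩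
  have hone : ∀ i, ∀ j ∈ Finset.Icc 1 n, P.law O D T w n (E 1 i j ∪ E (-1) i j)
      ≤ ENNReal.ofReal (2 * Real.exp (-(3 * L))) := by
    intro i j hj
    have hj0 : 0 < j := (Finset.mem_Icc.1 hj).1
    refine (measure_union_le _ _).trans ((add_le_add
      (P.law_deviation_le O T w hD i hL (by norm_num) hj0)
      (P.law_deviation_le O T w hD i hL (by norm_num) hj0)).trans_eq ?_)
    rw [← ENNReal.ofReal_add (by positivity) (by positivity), two_mul]
  refine (measure_mono hsub).trans ((measure_biUnion_finset_le _ _).trans ?_)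
  refine (Finset.sum_le_sum fun i _ => (measure_biUnion_finset_le _ _).trans
    (Finset.sum_le_sum (hone i))).trans ?_
  simp only [Finset.sum_const, Nat.card_Icc, Finset.card_univ, Fintype.card_fin, nsmul_eq_mul,
    Nat.add_sub_cancel]
  rw [← ENNReal.ofReal_natCast, ← ENNReal.ofReal_natCast, ← ENNReal.ofReal_mul (by positivity),
    ← ENNReal.ofReal_mul (by positivity)]
  exact ENNReal.ofReal_le_ofReal (by ring_nf; rfl)

end Concentration

/-! ### Drift of the means and upper confidence bounds -/

section Drift

variable {m : ℕ}

/-- The variation of the mean vectors within the window of round `n`. -/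
noncomputable def drift (D : ℕ → Measure (Fin m → ℝ)) (w n : ℕ) : ℝ :=
  ∑ k ∈ Finset.Ico (n + 1 - w) n, ‖mean (D (k + 1)) - mean (D k)‖

theorem drift_nonneg (D : ℕ → Measure (Fin m → ℝ)) (w n : ℕ) : 0 ≤ drift D w n :=
  Finset.sum_nonneg fun _ _ => norm_nonneg _

theorem abs_mean_sub_mean_le_drift (D : ℕ → Measure (Fin m → ℝ)) {w n s : ℕ} (hs : s ≤ n)
    (hsw : n + 1 ≤ s + w) (i : Fin m) : |mean (D s) i - mean (D n) i| ≤ drift D w n := by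
  have h1 : |mean (D s) i - mean (D n) i| ≤ dist (mean (D s)) (mean (D n)) := by
    rw [dist_eq_norm]
    exact norm_le_pi_norm (mean (D s) - mean (D n)) i
  refine h1.trans ((dist_le_Ico_sum_dist (fun k => mean (D k)) hs).trans ?_)
  refine (Finset.sum_le_sum fun k _ => ?_).trans (Finset.sum_le_sum_of_subset_of_nonneg
    (Finset.Ico_subset_Ico_left (by omega)) fun _ _ _ => norm_nonneg _)
  rw [dist_eq_norm, norm_sub_rev]

/-- Each change of the mean vector lies in fewer than `w` windows. -/
theorem sum_drift_le (D : ℕ → Measure (Fin m → ℝ)) (w T : ℕ) :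
    ∑ n ∈ Finset.range T, drift D w n ≤ w * variation D T := by
  have h1 : ∀ n ∈ Finset.range T, drift D w n = ∑ k ∈ Finset.range (T - 1),
      if k < n ∧ n < k + w then ‖mean (D (k + 1)) - mean (D k)‖ else 0 := by
    intro n hn
    rw [Finset.mem_range] at hn
    rw [← Finset.sum_filter, drift]
    refine Finset.sum_congr ?_ fun _ _ => rfl
    ext k
    simp only [Finset.mem_Ico, Finset.mem_filter, Finset.mem_range]
    omega
  rw [Finset.sum_congr rfl h1, Finset.sum_comm, variation, Finset.mul_sum]
  refine Finset.sum_le_sum fun k _ => ?_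
  rw [← Finset.sum_filter, Finset.sum_const, nsmul_eq_mul]
  refine mul_le_mul_of_nonneg_right (Nat.cast_le.2 ?_) (norm_nonneg _)
  refine (Finset.card_le_card (t := Finset.Ico k (k + w)) fun n hn => ?_).trans (by simp)
  simp only [Finset.mem_filter, Finset.mem_Ico] at hn ⊢
  omega

end Drift

section Ucb

variable {m : ℕ} {𝕊 : Type*}

theorem ucb_mem {T w n : ℕ} {h : Fin n → Round m 𝕊}
    (hX : ∀ s, (h s).2.1 ∈ Set.Icc (0 : Fin m → ℝ) 1) :
    ucb T w n h ∈ Set.Icc (0 : Fin m → ℝ) 1 := by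
  have hobs : ∀ i, 0 ≤ obsSum w n h i := fun i => Finset.sum_nonneg fun s _ => by
    split_ifs
    exacts [(hX s).1 i, le_rfl]
  constructor <;> intro i <;> simp only [ucb, Pi.zero_apply, Pi.one_apply] <;> split_ifs
  · exact zero_le_one
  · exact le_min (add_nonneg (div_nonneg (hobs i) (Nat.cast_nonneg _)) (Real.sqrt_nonneg _))
      zero_le_one
  · exact le_rfl
  · exact min_le_right _ _

theorem abs_meanSum_sub_le (D : ℕ → Measure (Fin m → ℝ)) (w n : ℕ) (h : Fin n → Round m 𝕊)
    (i : Fin m) :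
    |meanSum D w n h i - count w n h i * mean (D n) i| ≤ count w n h i * drift D w n := by
  unfold meanSum count
  push_cast
  rw [Finset.sum_mul, Finset.sum_mul, ← Finset.sum_sub_distrib]
  refine (Finset.abs_sum_le_sum_abs _ _).trans (Finset.sum_le_sum fun s _ => ?_)
  split_ifs with hs
  · simpa using abs_mean_sub_mean_le_drift D s.2.le hs.1 i
  · simp

/-- Outside the deviation set the upper confidence bounds are optimistic up to the drift, and their
error is at most the confidence width plus the drift. -/
theorem ucb_spec {D : ℕ → Measure (Fin m → ℝ)} {T w n : ℕ} {h : Fin n → Round m 𝕊}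
    (hX : ∀ s, (h s).2.1 ∈ Set.Icc (0 : Fin m → ℝ) 1)
    (hμ : mean (D n) ∈ Set.Icc (0 : Fin m → ℝ) 1)
    (hdev : h ∉ deviationSet D (Real.log T) w n) (i : Fin m) :
    mean (D n) i - drift D w n ≤ ucb T w n h i ∧
      |mean (D n) i - ucb T w n h i|
        ≤ confWidth (Real.log T) (count w n h i) + drift D w n := by
  have hv := drift_nonneg D w n
  have hμ0 : 0 ≤ mean (D n) i := hμ.1 i
  have hμ1 : mean (D n) i ≤ 1 := hμ.2 i
  have hu0 : 0 ≤ ucb T w n h i := (ucb_mem hX).1 i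
  have hu1 : ucb T w n h i ≤ 1 := (ucb_mem hX).2 i
  by_cases h0 : count w n h i = 0
  · have hu : ucb T w n h i = 1 := by rw [ucb, if_pos h0]
    rw [hu, h0, confWidth, if_pos rfl, abs_le]
    refine ⟨by linarith, by linarith, by linarith⟩
  have hN : (0 : ℝ) < count w n h i := by exact_mod_cast Nat.pos_of_ne_zero h0
  have hd : |obsSum w n h i - meanSum D w n h i|
      ≤ √(3 * Real.log T * count w n h i / 2) := by
    by_contra hlt
    exact hdev ⟨i, not_le.1 hlt⟩
  have hm := abs_meanSum_sub_le D w n h i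
  have hL : 0 ≤ Real.log T := Real.log_natCast_nonneg T
  set N : ℝ := ((count w n h i : ℕ) : ℝ) with hNdef
  set ρ := √(3 * Real.log T / (2 * N)) with hρ
  have hρ0 : 0 ≤ ρ := Real.sqrt_nonneg _
  have hrad : √(3 * Real.log T * N / 2) = N * ρ := by
    rw [hρ, show 3 * Real.log T * N / 2 = N ^ 2 * (3 * Real.log T / (2 * N)) by field_simp,
      Real.sqrt_mul (by positivity), Real.sqrt_sq hN.le]
  rw [hrad] at hd
  have hdist : |obsSum w n h i / N - mean (D n) i| ≤ ρ + drift D w n := by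
    have h1 : obsSum w n h i / N - mean (D n) i
        = (obsSum w n h i - N * mean (D n) i) / N := by field_simp
    rw [h1, abs_div, abs_of_pos hN, div_le_iff₀ hN]
    have h2 := abs_add_le (obsSum w n h i - meanSum D w n h i)
      (meanSum D w n h i - N * mean (D n) i)
    rw [sub_add_sub_cancel] at h2
    linarith
  rw [abs_le] at hdist
  have hu : ucb T w n h i = min (obsSum w n h i / N + ρ) 1 := by rw [ucb, if_neg h0]
  have hlow : mean (D n) i - drift D w n ≤ ucb T w n h i := by
    rw [hu]
    exact le_min (by linarith) (by linarith)
  have hup : ucb T w n h i ≤ mean (D n) i + 2 * ρ + drift D w n := by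
    rw [hu]
    exact (min_le_left _ _).trans (by linarith)
  refine ⟨hlow, ?_⟩
  rw [confWidth, if_neg h0, abs_le, min_add]
  have h2 : |mean (D n) i - ucb T w n h i| ≤ min (1 + drift D w n) (2 * ρ + drift D w n) :=
    le_min (abs_le.2 ⟨by linarith, by linarith⟩) (abs_le.2 ⟨by linarith, by linarith⟩)
  exact abs_le.1 h2

end Ucb

/-! ### Regret of one round -/

section OneRound

variable {m : ℕ} {𝕊 : Type*} [MeasurableSpace 𝕊]

open Classical in
/-- The expected charge of the triggered arms is the charge weighted by the triggering
probabilities. -/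
theorem Problem.lintegral_charge (P : Problem m 𝕊) {D : Measure (Fin m → ℝ)} (hD : D ∈ P.envs)
    (S : 𝕊) (c : ℝ) {a : Fin m → ℝ} (ha : ∀ i, 0 ≤ a i) (hc : 0 ≤ c) :
    ∫⁻ y, (ENNReal.ofReal c + ∑ i, if i ∈ y.2 then ENNReal.ofReal (a i) else 0)
      ∂(outcomeKernel P.trig D S) = ENNReal.ofReal (c + ∑ i, trigProb P.trig D S i * a i) := by
  have := P.isMarkovKernel_outcomeKernel hD
  rw [lintegral_add_left measurable_const, lintegral_const, measure_univ, mul_one,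
    lintegral_finsetSum _ fun i _ =>
      Measurable.ite (measurableSet_mem_trig i) measurable_const measurable_const,
    ENNReal.ofReal_add hc (Finset.sum_nonneg fun i _ => mul_nonneg (trigProb_nonneg _ _ _ _) (ha i)),
    ENNReal.ofReal_sum_of_nonneg fun i _ => mul_nonneg (trigProb_nonneg _ _ _ _) (ha i)]
  congr 1
  refine Finset.sum_congr rfl fun i _ => ?_
  have h1 : ∫⁻ y, (if i ∈ y.2 then ENNReal.ofReal (a i) else 0) ∂(outcomeKernel P.trig D S)
      = ∫⁻ y, Set.indicator {z : (Fin m → ℝ) × Set (Fin m) | i ∈ z.2}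
        (fun _ => ENNReal.ofReal (a i)) y ∂(outcomeKernel P.trig D S) :=
    lintegral_congr fun y => by simp [Set.indicator_apply]
  rw [h1, lintegral_indicator_const (measurableSet_mem_trig i),
    ENNReal.ofReal_mul (trigProb_nonneg _ _ _ _), mul_comm, trigProb, ofReal_measureReal]

open Classical in
/-- One round of the algorithm, given the history. The expected charge
`∑ i, p_i · excess` is written as an integral of the charge of the triggered arms; this is what
makes counting observations possible later. -/
theorem Problem.opt_le_lintegral_stepKernel (P : Problem m 𝕊) {B α β : ℝ} (hB : 0 ≤ B)
    {O : Kernel (Fin m → ℝ) 𝕊} {D : ℕ → Measure (Fin m → ℝ)} {T : ℕ}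
    (hP : P.Admissible B α β O D T) (w : ℕ) {e : ℝ} (he : 0 ≤ e) {δ : Fin m → ℝ} {n : ℕ}
    (hn : n < T)
    (hδ : ∀ S, 0 < P.gap α (D n) S →
      ∑ i, trigProb P.trig (D n) S i * δ i ≤ P.gap α (D n) S + e)
    {h : Fin n → Round m 𝕊} (hX : ∀ s, (h s).2.1 ∈ Set.Icc (0 : Fin m → ℝ) 1) :
    ENNReal.ofReal (α * β * P.opt (mean (D n)))
      ≤ ∫⁻ z, (ENNReal.ofReal (P.r z.1 (mean (D n))) + ∑ i, if i ∈ z.2.2 then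
          ENNReal.ofReal (excess B (Real.log T) (δ i) (count w n h i)) else 0)
          ∂(P.stepKernel O T w n (D n) h)
        + (ENNReal.ofReal (4 * B * P.maxTrig D T * drift D w n + e)
        + (deviationSet D (Real.log T) w n).indicator
          (fun _ => ENNReal.ofReal (2 * B * P.maxTrig D T)) h) := by
  have hD := hP.env n hn
  have := hP.oracle.1
  have hμ := P.mean_mem hD
  have hu := ucb_mem (T := T) (w := w) hX
  have hK := P.sum_trigProb_le hn hD
  have hopt := P.opt_nonneg hD
  set μ := mean (D n)
  set u := ucb T w n h with hudef
  set K : ℝ := ((P.maxTrig D T : ℕ) : ℝ)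
  have hK0 : 0 ≤ K := Nat.cast_nonneg _
  set A := {S | α * P.opt u ≤ P.r S u} with hA
  have hAm : MeasurableSet A := measurableSet_le measurable_const (P.r_measurable u hu)
  set C := ENNReal.ofReal (4 * B * K * drift D w n + e)
    + (deviationSet D (Real.log T) w n).indicator (fun _ => ENNReal.ofReal (2 * B * K)) h with hC
  have hf : Measurable fun z : Round m 𝕊 => ENNReal.ofReal (P.r z.1 μ) + ∑ i,
      if i ∈ z.2.2 then ENNReal.ofReal (excess B (Real.log T) (δ i) (count w n h i)) else 0 := by
    refine ((P.r_measurable μ hμ).comp measurable_fst).ennreal_ofReal.add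
      (Finset.measurable_sum _ fun i _ => ?_)
    exact Measurable.ite ((measurableSet_mem_trig i).preimage measurable_snd)
      measurable_const measurable_const
  rw [P.lintegral_stepKernel O T w n hD h hf]
  rw [lintegral_congr fun S => P.lintegral_charge hD S (P.r S μ)
    (a := fun i => excess B (Real.log T) (δ i) (count w n h i))
    (fun i => excess_nonneg _ _ _ _) (P.r_nonneg hD S)]
  have hsum : ∀ S, 0 ≤ ∑ i, trigProb P.trig (D n) S i
      * excess B (Real.log T) (δ i) (count w n h i) := fun S =>
    Finset.sum_nonneg fun i _ => mul_nonneg (trigProb_nonneg _ _ _ _) (excess_nonneg _ _ _ _)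
  have hpoint : ∀ S, A.indicator (fun _ => ENNReal.ofReal (α * P.opt μ)) S
      ≤ ENNReal.ofReal (P.r S μ + ∑ i, trigProb P.trig (D n) S i
        * excess B (Real.log T) (δ i) (count w n h i)) + C := by
    intro S
    by_cases hS : S ∈ A
    swap
    · rw [Set.indicator_of_notMem hS]
      exact zero_le
    rw [Set.indicator_of_mem hS]
    have hgap : α * P.opt μ ≤ P.r S μ + P.gap α (D n) S := by
      have : α * P.opt μ - P.r S μ ≤ P.gap α (D n) S := le_max_right _ _
      linarith
    have hr := P.r_nonneg hD S
    by_cases hdev : h ∈ deviationSet D (Real.log T) w n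
    · have h1 := P.gap_le_two_mul hB hP.α_mem hP.monotone hP.smooth hD hK hu hS
      rw [hC, Set.indicator_of_mem hdev]
      refine le_trans ?_ (add_le_add_right le_add_self _)
      rw [← ENNReal.ofReal_add (add_nonneg hr (hsum S)) (by positivity)]
      refine ENNReal.ofReal_le_ofReal ?_
      linarith [hsum S]
    · have h1 := P.gap_le_sum_excess hB hP.α_mem hP.monotone hP.smooth hD hK he hu
        (drift_nonneg D w n) (fun i => (ucb_spec hX hμ hdev i).1)
        (fun i => (ucb_spec hX hμ hdev i).2) (hδ S) hS
      rw [hC, Set.indicator_of_notMem hdev, add_zero]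
      have hv := drift_nonneg D w n
      rw [← ENNReal.ofReal_add (add_nonneg hr (hsum S)) (by positivity)]
      refine ENNReal.ofReal_le_ofReal ?_
      linarith
  calc ENNReal.ofReal (α * β * P.opt μ)
      = ENNReal.ofReal (α * P.opt μ) * ENNReal.ofReal β := by
        rw [← ENNReal.ofReal_mul (mul_nonneg hP.α_mem.1 hopt)]
        ring_nf
    _ ≤ ENNReal.ofReal (α * P.opt μ) * O u A := by
        gcongr
        exact hP.oracle.2 u hu
    _ = ∫⁻ S, A.indicator (fun _ => ENNReal.ofReal (α * P.opt μ)) S ∂(O u) :=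
        (lintegral_indicator_const hAm _).symm
    _ ≤ ∫⁻ S, (ENNReal.ofReal (P.r S μ + ∑ i, trigProb P.trig (D n) S i
        * excess B (Real.log T) (δ i) (count w n h i)) + C) ∂(O u) := lintegral_mono hpoint
    _ = _ := by
        rw [lintegral_add_right _ measurable_const, lintegral_const, measure_univ, mul_one]

end OneRound

/-! ### Regret of all rounds -/

section Prefix

variable {m : ℕ} {𝕊 : Type*}

/-- The history before the round `t`. -/
def before {n : ℕ} (h : Fin n → Round m 𝕊) (t : Fin n) : Fin t → Round m 𝕊 :=
  fun s => h (Fin.castLE t.2.le s)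

theorem before_snoc_castSucc {n : ℕ} (h : Fin n → Round m 𝕊) (z : Round m 𝕊) (t : Fin n) :
    before (Fin.snoc h z : Fin (n + 1) → Round m 𝕊) t.castSucc = before h t := by
  funext s
  exact Fin.snoc_castSucc (α := fun _ => Round m 𝕊) z h (Fin.castLE t.2.le s)

theorem before_snoc_last {n : ℕ} (h : Fin n → Round m 𝕊) (z : Round m 𝕊) :
    before (Fin.snoc h z : Fin (n + 1) → Round m 𝕊) (Fin.last n) = h := by
  funext s
  exact Fin.snoc_castSucc (α := fun _ => Round m 𝕊) z h s

open Classical in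
/-- Summed over time, the charges of an arm are at most one total per block of `w` rounds. -/
theorem sum_charge_le {ψ : ℕ → ℝ} (hanti : Antitone ψ) (hpos : ∀ j, 0 ≤ ψ j) {F : ℝ}
    (hF : ∀ N, ∑ j ∈ Finset.range N, ψ j ≤ F) {w : ℕ} (hw : 0 < w) {T : ℕ}
    (h : Fin T → Round m 𝕊) (i : Fin m) :
    ∑ t : Fin T, (if i ∈ (h t).2.2 then ψ (count w t (before h t) i) else 0)
      ≤ (T / w + 1 : ℕ) * F := by
  set b : ℕ → Prop := fun t => ∃ ht : t < T, i ∈ (h ⟨t, ht⟩).2.2 with hb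
  refine le_trans (Eq.le ?_) (sum_window_le b hanti hpos hF hw T)
  rw [Finset.sum_range]
  refine Finset.sum_congr rfl fun t _ => ?_
  have h1 : (i ∈ (h t).2.2) ↔ b t := ⟨fun hi => ⟨t.2, hi⟩, fun ⟨_, hi⟩ => hi⟩
  have h2 : count w t (before h t) i
      = Finset.card {s ∈ Finset.range t | (t : ℕ) + 1 ≤ s + w ∧ b s} := by
    rw [count, Finset.card_filter, Finset.sum_range]
    refine Finset.sum_congr rfl fun s _ => ?_
    have h3 : (i ∈ (before h t s).2.2) ↔ b s :=
      ⟨fun hi => ⟨s.2.trans t.2, hi⟩, fun ⟨_, hi⟩ => hi⟩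
    simp only [h3]
  rw [h2]
  simp only [h1]

end Prefix

section Regret

variable {m : ℕ} {𝕊 : Type*} [MeasurableSpace 𝕊]

theorem measurable_count (w n : ℕ) (i : Fin m) :
    Measurable fun h : Fin n → Round m 𝕊 => count w n h i := by
  unfold count
  refine Finset.measurable_sum _ fun s _ => ?_
  exact Measurable.ite (measurableSet_trig w n i s) measurable_const measurable_const

theorem measurable_before {n : ℕ} (t : Fin n) :
    Measurable fun h : Fin n → Round m 𝕊 => before h t :=
  measurable_pi_lambda _ fun _ => measurable_pi_apply _

open Classical in
theorem measurable_charge (w : ℕ) {n : ℕ} (ψ : ℕ → ℝ) (i : Fin m) (t : Fin n) :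
    Measurable fun h : Fin n → Round m 𝕊 =>
      if i ∈ (h t).2.2 then ENNReal.ofReal (ψ (count w t (before h t) i)) else 0 := by
  refine Measurable.ite ?_ ?_ measurable_const
  · simpa using measurableSet_mem_trig_apply (𝕊 := 𝕊) True i t
  · exact (measurable_from_top (f := fun j : ℕ => ENNReal.ofReal (ψ j))).comp
      ((measurable_count w t i).comp (measurable_before t))

open Classical in
/-- Summation of the one-round bounds along the recursive definition of the law. -/
theorem Problem.sum_opt_le_lintegral_law (P : Problem m 𝕊) {B α β : ℝ} (hB : 0 ≤ B)
    {O : Kernel (Fin m → ℝ) 𝕊} {D : ℕ → Measure (Fin m → ℝ)} {T : ℕ}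
    (hP : P.Admissible B α β O D T) (w : ℕ) {e : ℝ} (he : 0 ≤ e) {δ : Fin m → ℝ}
    (hδ : ∀ t < T, ∀ S, 0 < P.gap α (D t) S →
      ∑ i, trigProb P.trig (D t) S i * δ i ≤ P.gap α (D t) S + e) {n : ℕ} (hn : n ≤ T) :
    ∑ t ∈ Finset.range n, ENNReal.ofReal (α * β * P.opt (mean (D t)))
      ≤ ∫⁻ h, ∑ t : Fin n, (ENNReal.ofReal (P.r (h t).1 (mean (D t))) +
          ∑ i, if i ∈ (h t).2.2 then ENNReal.ofReal
            (excess B (Real.log T) (δ i) (count w t (before h t) i)) else 0)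
          ∂(P.law O D T w n)
        + ∑ t ∈ Finset.range n, (ENNReal.ofReal (4 * B * P.maxTrig D T * drift D w t + e)
          + ENNReal.ofReal (2 * B * P.maxTrig D T)
            * P.law O D T w t (deviationSet D (Real.log T) w t)) := by
  have := hP.oracle.1
  induction n with
  | zero => simp
  | succ n ih =>
    have hn' : n < T := hn
    have hD : ∀ t < n, D t ∈ P.envs := fun t ht => hP.env t (ht.trans hn')
    have hDn := hP.env n hn'
    have hμ := fun t (ht : t < T) => P.mean_mem (hP.env t ht)
    have := P.isProbabilityMeasure_law O T w hD
    have := P.isMarkovKernel_stepKernel O T w n hDn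
    have hmeas : ∀ k ≤ T, Measurable fun h : Fin k → Round m 𝕊 => ∑ t : Fin k,
        (ENNReal.ofReal (P.r (h t).1 (mean (D t))) + ∑ i, if i ∈ (h t).2.2 then ENNReal.ofReal
            (excess B (Real.log T) (δ i) (count w t (before h t) i)) else 0) := by
      intro k hk
      refine Finset.measurable_sum _ fun t _ => Measurable.add ?_
        (Finset.measurable_sum _ fun i _ => measurable_charge w _ i t)
      exact ((P.r_measurable _ (hμ t (t.2.trans_le hk))).comp
        (measurable_fst.comp (measurable_pi_apply t))).ennreal_ofReal
    rw [P.lintegral_law_succ O T w (fun t ht => hP.env t (ht.trans_le hn)) (hmeas _ hn)]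
    simp only [Fin.sum_univ_castSucc, Fin.snoc_castSucc, Fin.snoc_last, before_snoc_castSucc,
      before_snoc_last, Fin.val_castSucc, Fin.val_last]
    rw [Finset.sum_range_succ, Finset.sum_range_succ]
    set K : ℝ := ((P.maxTrig D T : ℕ) : ℝ)
    set f : (Fin n → Round m 𝕊) → Round m 𝕊 → ℝ≥0∞ := fun h z =>
      ENNReal.ofReal (P.r z.1 (mean (D n))) + ∑ i, if i ∈ z.2.2 then
        ENNReal.ofReal (excess B (Real.log T) (δ i) (count w n h i)) else 0 with hf
    have hfm : Measurable (Function.uncurry f) := by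
      refine Measurable.add (((P.r_measurable _ (hμ n hn')).comp
        (measurable_fst.comp measurable_snd)).ennreal_ofReal)
        (Finset.measurable_sum _ fun i _ => Measurable.ite ?_ ?_ measurable_const)
      · exact (measurableSet_mem_trig i).preimage (measurable_snd.comp measurable_snd)
      · exact (measurable_from_top (f := fun j : ℕ =>
          ENNReal.ofReal (excess B (Real.log T) (δ i) j))).comp
            ((measurable_count w n i).comp measurable_fst)
    have hstep : ENNReal.ofReal (α * β * P.opt (mean (D n)))
        ≤ ∫⁻ h, ∫⁻ z, f h z ∂(P.stepKernel O T w n (D n) h) ∂(P.law O D T w n)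
        + (ENNReal.ofReal (4 * B * K * drift D w n + e) + ENNReal.ofReal (2 * B * K)
            * P.law O D T w n (deviationSet D (Real.log T) w n)) := by
      calc ENNReal.ofReal (α * β * P.opt (mean (D n)))
          = ∫⁻ _, ENNReal.ofReal (α * β * P.opt (mean (D n))) ∂(P.law O D T w n) := by simp
        _ ≤ _ := lintegral_mono_ae ((P.ae_law O T w hD).mono fun h hX =>
              P.opt_le_lintegral_stepKernel hB hP w he hn' (hδ n hn') hX)
        _ = ∫⁻ h, ∫⁻ z, f h z ∂(P.stepKernel O T w n (D n) h) ∂(P.law O D T w n)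
            + (ENNReal.ofReal (4 * B * K * drift D w n + e)
            + ∫⁻ h, (deviationSet D (Real.log T) w n).indicator
              (fun _ => ENNReal.ofReal (2 * B * K)) h ∂(P.law O D T w n)) := by
          rw [lintegral_add_left hfm.lintegral_kernel_prod_right,
            lintegral_add_left measurable_const, lintegral_const, measure_univ, mul_one]
        _ ≤ _ := by
          gcongr
          exact lintegral_indicator_const_le _ _
    have hsplit : ∀ h : Fin n → Round m 𝕊, ∀ c : ℝ≥0∞,
        ∫⁻ z, (c + f h z) ∂(P.stepKernel O T w n (D n) h)
          = c + ∫⁻ z, f h z ∂(P.stepKernel O T w n (D n) h) := by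
      intro h c
      rw [lintegral_add_left measurable_const, lintegral_const, measure_univ, mul_one]
    simp only [hf] at hsplit hstep
    simp only [hsplit]
    rw [lintegral_add_left (hmeas n hn'.le)]
    refine (add_le_add (ih hn'.le) hstep).trans_eq ?_
    ring

/-- The failures of concentration cost `4 B K m` in total, since each round has failure
probability at most `2 m / T`. -/
theorem Problem.sum_deviation_le (P : Problem m 𝕊) {B α β : ℝ} (hB : 0 ≤ B)
    {O : Kernel (Fin m → ℝ) 𝕊} {D : ℕ → Measure (Fin m → ℝ)} {T : ℕ}
    (hP : P.Admissible B α β O D T) (w : ℕ) :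
    ∑ t ∈ Finset.range T, ENNReal.ofReal (2 * B * P.maxTrig D T)
        * P.law O D T w t (deviationSet D (Real.log T) w t)
      ≤ ENNReal.ofReal (4 * B * P.maxTrig D T * m) := by
  have := hP.oracle.1
  rcases Nat.eq_zero_or_pos T with rfl | hT
  · simp
  have hT' : (0 : ℝ) < T := by exact_mod_cast hT
  have hT1 : (1 : ℝ) ≤ T := by exact_mod_cast hT
  have h1 : ∀ t ∈ Finset.range T, ENNReal.ofReal (2 * B * P.maxTrig D T)
        * P.law O D T w t (deviationSet D (Real.log T) w t)
      ≤ ENNReal.ofReal (4 * B * P.maxTrig D T * m / T) := by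
    intro t ht
    rw [Finset.mem_range] at ht
    refine (mul_le_mul_right (P.law_deviationSet_le O T w
      (fun s hs => hP.env s (hs.trans ht)) (Real.log_natCast_nonneg T)) _).trans ?_
    rw [← ENNReal.ofReal_mul (by positivity)]
    refine ENNReal.ofReal_le_ofReal ?_
    have h2 : Real.exp (-(3 * Real.log T)) = ((T : ℝ) ^ 3)⁻¹ := by
      rw [Real.exp_neg, mul_comm, Real.exp_mul, Real.exp_log hT']
      norm_cast
    have ht' : (t : ℝ) ≤ T := by exact_mod_cast ht.le
    have h3 : (t : ℝ) * ((T : ℝ) ^ 3)⁻¹ ≤ 1 / T := by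
      rw [← div_eq_mul_inv, div_le_div_iff₀ (by positivity) hT']
      nlinarith [pow_le_pow_right₀ hT1 (show 2 ≤ 3 by norm_num)]
    rw [h2]
    calc 2 * B * (P.maxTrig D T) * (2 * m * t * ((T : ℝ) ^ 3)⁻¹)
        = 4 * B * (P.maxTrig D T) * m * (t * ((T : ℝ) ^ 3)⁻¹) := by ring
      _ ≤ 4 * B * (P.maxTrig D T) * m * (1 / T) := by gcongr
      _ = _ := by ring
  refine (Finset.sum_le_sum h1).trans ?_
  rw [Finset.sum_const, Finset.card_range, nsmul_eq_mul, ← ENNReal.ofReal_natCast,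
    ← ENNReal.ofReal_mul (by positivity)]
  refine ENNReal.ofReal_le_ofReal (Eq.le ?_)
  field_simp

theorem Problem.integrable_reward (P : Problem m 𝕊) {B α β : ℝ}
    {O : Kernel (Fin m → ℝ) 𝕊} {D : ℕ → Measure (Fin m → ℝ)} {T : ℕ}
    (hP : P.Admissible B α β O D T) (w : ℕ) :
    Integrable (fun h : Fin T → Round m 𝕊 => ∑ t : Fin T, P.r (h t).1 (mean (D t)))
      (P.law O D T w T) := by
  have := hP.oracle.1
  have := P.isProbabilityMeasure_law O T w hP.env
  have hμ := fun t (ht : t < T) => P.mean_mem (hP.env t ht)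
  refine integrable_finsetSum _ fun t _ => Integrable.of_mem_Icc 0 (P.opt (mean (D t)))
    ((P.r_measurable _ (hμ t t.2)).comp (measurable_fst.comp (measurable_pi_apply t))).aemeasurable
    (Filter.Eventually.of_forall fun h => ⟨P.r_nonneg (hP.env t t.2) _, P.r_le_opt (hμ t t.2) _⟩)

/-- The regret for arbitrary thresholds `δ i`, which a positive gap has to pay for up to `e`. -/
theorem Problem.regret_le (P : Problem m 𝕊) {B α β : ℝ} (hB : 0 ≤ B)
    {O : Kernel (Fin m → ℝ) 𝕊} {D : ℕ → Measure (Fin m → ℝ)} {T : ℕ}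
    (hP : P.Admissible B α β O D T) {w : ℕ} (hw : 0 < w) {e : ℝ} (he : 0 ≤ e) {δ : Fin m → ℝ}
    (hδ0 : ∀ i, 0 < δ i) (hδ : ∀ t < T, ∀ S, 0 < P.gap α (D t) S →
      ∑ i, trigProb P.trig (D t) S i * δ i ≤ P.gap α (D t) S + e) :
    P.regret α β O D T w ≤ (T / w + 1 : ℕ) * ∑ i, excessBound B (Real.log T) (δ i)
      + 4 * B * P.maxTrig D T * w * variation D T + e * T + 4 * B * P.maxTrig D T * m := by
  classical
  have := hP.oracle.1
  have := P.isProbabilityMeasure_law O T w hP.env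
  have hL := Real.log_natCast_nonneg T
  have hμ := fun t (ht : t < T) => P.mean_mem (hP.env t ht)
  have hlaw := P.sum_opt_le_lintegral_law hB hP w he hδ le_rfl
  set K : ℝ := ((P.maxTrig D T : ℕ) : ℝ)
  set F := ∑ i, excessBound B (Real.log T) (δ i) with hF
  have hexc := fun i => sum_excess_le_excessBound hB hL (hδ0 i)
  have hF0 : 0 ≤ F := Finset.sum_nonneg fun i _ => by simpa using hexc i 0
  have hrm : ∀ t : Fin T, Measurable fun h : Fin T → Round m 𝕊 => P.r (h t).1 (mean (D t)) :=
    fun t => (P.r_measurable _ (hμ t t.2)).comp (measurable_fst.comp (measurable_pi_apply t))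
  have hr0 : ∀ (t : Fin T) (h : Fin T → Round m 𝕊), 0 ≤ P.r (h t).1 (mean (D t)) :=
    fun t h => P.r_nonneg (hP.env t t.2) _
  have hri := P.integrable_reward hP w
  have hreward : ∫⁻ h, ∑ t : Fin T, ENNReal.ofReal (P.r (h t).1 (mean (D t)))
      ∂(P.law O D T w T)
      = ENNReal.ofReal (∫ h, ∑ t : Fin T, P.r (h t).1 (mean (D t)) ∂(P.law O D T w T)) := by
    rw [ofReal_integral_eq_lintegral_ofReal hri
      (Filter.Eventually.of_forall fun h => Finset.sum_nonneg fun t _ => hr0 t h)]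
    exact lintegral_congr fun h =>
      (ENNReal.ofReal_sum_of_nonneg fun t _ => hr0 t h).symm
  have hcharge : ∀ h : Fin T → Round m 𝕊, ∑ t : Fin T, ∑ i, (if i ∈ (h t).2.2 then
      ENNReal.ofReal (excess B (Real.log T) (δ i) (count w t (before h t) i)) else 0)
      ≤ ENNReal.ofReal ((T / w + 1 : ℕ) * F) := by
    intro h
    rw [Finset.sum_comm, hF, Finset.mul_sum, ENNReal.ofReal_sum_of_nonneg fun i _ =>
      mul_nonneg (Nat.cast_nonneg _) (by simpa using hexc i 0)]
    refine Finset.sum_le_sum fun i _ => ?_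
    have h1 := sum_charge_le (excess_antitone hB hL (δ i)) (excess_nonneg B _ _) (hexc i) hw h i
    refine le_trans (Eq.le ?_) (ENNReal.ofReal_le_ofReal h1)
    rw [ENNReal.ofReal_sum_of_nonneg fun t _ => by split_ifs; exacts [excess_nonneg _ _ _ _, le_rfl]]
    refine Finset.sum_congr rfl fun t _ => ?_
    split_ifs <;> simp
  have hint : ∫⁻ h, ∑ t : Fin T, (ENNReal.ofReal (P.r (h t).1 (mean (D t))) +
      ∑ i, if i ∈ (h t).2.2 then ENNReal.ofReal
        (excess B (Real.log T) (δ i) (count w t (before h t) i)) else 0) ∂(P.law O D T w T)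
      ≤ ENNReal.ofReal (∫ h, ∑ t : Fin T, P.r (h t).1 (mean (D t)) ∂(P.law O D T w T))
        + ENNReal.ofReal ((T / w + 1 : ℕ) * F) := by
    simp only [Finset.sum_add_distrib]
    rw [lintegral_add_left (Finset.measurable_sum _ fun t _ => (hrm t).ennreal_ofReal), hreward]
    refine add_le_add_right ((lintegral_mono hcharge).trans ?_) _
    rw [lintegral_const, measure_univ, mul_one]
  have hdrift : ∑ t ∈ Finset.range T, ENNReal.ofReal (4 * B * K * drift D w t + e)
      ≤ ENNReal.ofReal (4 * B * K * w * variation D T + e * T) := by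
    have hv := drift_nonneg D w
    rw [← ENNReal.ofReal_sum_of_nonneg fun t _ => by have := hv t; positivity]
    refine ENNReal.ofReal_le_ofReal ?_
    rw [Finset.sum_add_distrib, ← Finset.mul_sum, Finset.sum_const, Finset.card_range,
      nsmul_eq_mul]
    have h1 := mul_le_mul_of_nonneg_left (sum_drift_le D w T)
      (show 0 ≤ 4 * B * K by positivity)
    linarith
  rw [Finset.sum_add_distrib, ← ENNReal.ofReal_sum_of_nonneg fun t ht => mul_nonneg
    (mul_nonneg hP.α_mem.1 hP.β_mem.1) (P.opt_nonneg (hP.env t (Finset.mem_range.1 ht)))] at hlaw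
  have hV : 0 ≤ variation D T := Finset.sum_nonneg fun _ _ => norm_nonneg _
  have hI : 0 ≤ ∫ h, ∑ t : Fin T, P.r (h t).1 (mean (D t)) ∂(P.law O D T w T) :=
    integral_nonneg fun h => Finset.sum_nonneg fun t _ => hr0 t h
  have htot := hlaw.trans (add_le_add hint (add_le_add hdrift (P.sum_deviation_le hB hP w)))
  rw [← ENNReal.ofReal_add hI (by positivity), ← ENNReal.ofReal_add (by positivity) (by positivity),
    ← ENNReal.ofReal_add (by positivity) (by positivity),
    ENNReal.ofReal_le_ofReal_iff (by positivity), ← Finset.mul_sum] at htot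
  rw [Problem.regret]
  linarith

end Regret

/-! ### Choice of the window -/

section Window

/-- Rounding the window down at most halves it. -/
theorem floor_window {x : ℝ} (hx : 1 ≤ x) {T : ℕ} (hT : 0 < T) :
    0 < ⌊min x T⌋₊ ∧ (⌊min x (T : ℝ)⌋₊ : ℝ) ≤ x ∧ ⌊min x (T : ℝ)⌋₊ ≤ T ∧
      (T : ℝ) / ⌊min x (T : ℝ)⌋₊ ≤ 2 * (T / x + 1) := by
  have hT1 : (1 : ℝ) ≤ T := by exact_mod_cast hT
  have hmin : 1 ≤ min x (T : ℝ) := le_min hx hT1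
  have hpos : 0 < ⌊min x (T : ℝ)⌋₊ := Nat.floor_pos.2 hmin
  have hle := Nat.floor_le (zero_le_one.trans hmin)
  refine ⟨hpos, hle.trans (min_le_left _ _), ?_, ?_⟩
  · exact_mod_cast hle.trans (min_le_right _ _)
  have hpos' : (1 : ℝ) ≤ ⌊min x (T : ℝ)⌋₊ := by exact_mod_cast hpos
  have hhalf : min x (T : ℝ) ≤ 2 * ⌊min x (T : ℝ)⌋₊ := by
    have := Nat.lt_floor_add_one (min x (T : ℝ))
    linarith
  have h1 : (T : ℝ) ≤ (T / x + 1) * min x T := by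
    have h0 : 0 ≤ T / x := by positivity
    rcases min_cases x (T : ℝ) with ⟨h, _⟩ | ⟨h, _⟩ <;> rw [h]
    · rw [add_mul, div_mul_cancel₀ _ (by positivity)]
      linarith
    · nlinarith
  rw [div_le_iff₀ (by positivity)]
  have h2 : 0 ≤ T / x + 1 := by positivity
  nlinarith

theorem windowDep_spec {T : ℕ} (hT : 0 < T) {v : ℝ} (hv : 0 ≤ v) (hvT : v ≤ T) :
    0 < windowDep T v ∧ windowDep T v * v ≤ √(v * T) ∧
      (T : ℝ) / windowDep T v ≤ 2 * (√(v * T) + 1) := by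
  have hT' : (0 : ℝ) < T := by exact_mod_cast hT
  unfold windowDep
  split_ifs with h0
  · subst h0
    refine ⟨hT, by simp, ?_⟩
    rw [div_self hT'.ne']
    simp
  have hv' : 0 < v := lt_of_le_of_ne hv (Ne.symm h0)
  have hx : 1 ≤ √(T / v) := Real.one_le_sqrt.2 ((one_le_div hv').2 hvT)
  obtain ⟨h1, h2, -, h4⟩ := floor_window hx hT
  refine ⟨h1, ?_, ?_⟩
  · refine (mul_le_mul_of_nonneg_right h2 hv).trans (Eq.le ?_)
    rw [show v * T = v ^ 2 * (T / v) by field_simp, Real.sqrt_mul (sq_nonneg v),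
      Real.sqrt_sq hv, mul_comm]
  · have h5 : (T : ℝ) / √(T / v) = √(v * T) := by
      rw [div_eq_iff (by positivity), ← Real.sqrt_mul (by positivity),
        show v * T * (T / v) = (T : ℝ) ^ 2 by field_simp, Real.sqrt_sq hT'.le]
    rwa [h5] at h4

theorem window_rpow_mul {m T K v : ℝ} (hm : 0 < m) (hT : 0 < T) (hK : 0 < K) (hv : 0 < v) :
    m ^ (1 / 3 : ℝ) * T ^ (2 / 3 : ℝ) * K ^ (-(1 / 3) : ℝ) * v ^ (-(2 / 3) : ℝ) * (K * v)
      = (m * v) ^ (1 / 3 : ℝ) * (K * T) ^ (2 / 3 : ℝ) := by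
  obtain ⟨a, rfl⟩ : ∃ a, Real.exp a = m := ⟨_, Real.exp_log hm⟩
  obtain ⟨b, rfl⟩ : ∃ b, Real.exp b = T := ⟨_, Real.exp_log hT⟩
  obtain ⟨c, rfl⟩ : ∃ c, Real.exp c = K := ⟨_, Real.exp_log hK⟩
  obtain ⟨d, rfl⟩ : ∃ d, Real.exp d = v := ⟨_, Real.exp_log hv⟩
  simp only [← Real.exp_mul, ← Real.exp_add]
  congr 1
  ring

theorem window_rpow_mul_sq {m T K v : ℝ} (hm : 0 < m) (hT : 0 < T) (hK : 0 < K) (hv : 0 < v) :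
    ((m * v) ^ (1 / 3 : ℝ) * (K * T) ^ (2 / 3 : ℝ)) ^ 2
      * (m ^ (1 / 3 : ℝ) * T ^ (2 / 3 : ℝ) * K ^ (-(1 / 3) : ℝ) * v ^ (-(2 / 3) : ℝ))
      = m * K * T * T := by
  obtain ⟨a, rfl⟩ : ∃ a, Real.exp a = m := ⟨_, Real.exp_log hm⟩
  obtain ⟨b, rfl⟩ : ∃ b, Real.exp b = T := ⟨_, Real.exp_log hT⟩
  obtain ⟨c, rfl⟩ : ∃ c, Real.exp c = K := ⟨_, Real.exp_log hK⟩
  obtain ⟨d, rfl⟩ : ∃ d, Real.exp d = v := ⟨_, Real.exp_log hv⟩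
  simp only [← Real.exp_mul, ← Real.exp_add, sq]
  congr 1
  ring

theorem one_le_window_rpow {m T K v : ℝ} (hK : 0 < K) (hv : 0 < v) (hKm : K ≤ m)
    (hvT : v ≤ T) :
    1 ≤ m ^ (1 / 3 : ℝ) * T ^ (2 / 3 : ℝ) * K ^ (-(1 / 3) : ℝ) * v ^ (-(2 / 3) : ℝ) := by
  have hm : 0 ≤ m := hK.le.trans hKm
  have hT : 0 ≤ T := hv.le.trans hvT
  calc (1 : ℝ) = K ^ (1 / 3 : ℝ) * v ^ (2 / 3 : ℝ) * K ^ (-(1 / 3) : ℝ) * v ^ (-(2 / 3) : ℝ) := by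
        rw [Real.rpow_neg hK.le, Real.rpow_neg hv.le]
        field_simp
    _ ≤ _ := by gcongr

theorem windowIndep_spec {m T K : ℕ} (hT : 0 < T) (hK : 0 < K) (hKm : K ≤ m) {v : ℝ}
    (hv : 0 ≤ v) (hvT : v ≤ T) :
    0 < windowIndep m T K v ∧ windowIndep m T K v ≤ T ∧
      K * windowIndep m T K v * v ≤ ((m : ℝ) * v) ^ (1 / 3 : ℝ) * ((K : ℝ) * T) ^ (2 / 3 : ℝ) ∧
      (m : ℝ) * K * T * (T / windowIndep m T K v)
        ≤ 2 * ((((m : ℝ) * v) ^ (1 / 3 : ℝ) * ((K : ℝ) * T) ^ (2 / 3 : ℝ)) ^ 2 + m * K * T) := by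
  have hT' : (0 : ℝ) < T := by exact_mod_cast hT
  have hK' : (0 : ℝ) < K := by exact_mod_cast hK
  have hm' : (0 : ℝ) < m := by exact_mod_cast hK.trans_le hKm
  unfold windowIndep
  split_ifs with h0
  · obtain rfl : v = 0 := h0.resolve_right hK.ne'
    refine ⟨hT, le_rfl, by simp, ?_⟩
    rw [div_self hT'.ne']
    have : 0 ≤ (m : ℝ) * K * T := by positivity
    nlinarith [sq_nonneg (((m : ℝ) * 0) ^ (1 / 3 : ℝ) * ((K : ℝ) * T) ^ (2 / 3 : ℝ))]
  have hv' : 0 < v := lt_of_le_of_ne hv fun h => h0 (Or.inl h.symm)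
  have hx := one_le_window_rpow hK' hv' (Nat.cast_le.2 hKm) hvT
  have h5 := window_rpow_mul hm' hT' hK' hv'
  have h6 := window_rpow_mul_sq hm' hT' hK' hv'
  obtain ⟨h1, h2, h3, h4⟩ := floor_window hx hT
  set x := (m : ℝ) ^ (1 / 3 : ℝ) * (T : ℝ) ^ (2 / 3 : ℝ) * (K : ℝ) ^ (-(1 / 3) : ℝ)
    * v ^ (-(2 / 3) : ℝ)
  refine ⟨h1, h3, ?_, ?_⟩
  · rw [← h5]
    have := mul_le_mul_of_nonneg_right h2 (mul_pos hK' hv').le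
    linarith
  · refine (mul_le_mul_of_nonneg_left h4 (by positivity)).trans (Eq.le ?_)
    have hx0 : x ≠ 0 := by positivity
    have h7 : (m : ℝ) * K * T * (T / x)
        = (((m : ℝ) * v) ^ (1 / 3 : ℝ) * ((K : ℝ) * T) ^ (2 / 3 : ℝ)) ^ 2 := by
      rw [← mul_div_assoc, ← h6, mul_div_cancel_right₀ _ hx0]
    rw [← h7]
    ring

end Window

/-! ### The two regret bounds -/

section Bounds

variable {m : ℕ} {𝕊 : Type*} [MeasurableSpace 𝕊]

theorem variation_nonneg (D : ℕ → Measure (Fin m → ℝ)) (T : ℕ) : 0 ≤ variation D T :=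
  Finset.sum_nonneg fun _ _ => norm_nonneg _

theorem Problem.variation_le_switchings (P : Problem m 𝕊) {D : ℕ → Measure (Fin m → ℝ)} {T : ℕ}
    (hD : ∀ t < T, D t ∈ P.envs) : variation D T ≤ switchings D T := by
  unfold variation switchings
  push_cast
  refine le_add_of_nonneg_of_le zero_le_one (Finset.sum_le_sum fun t ht => ?_)
  rw [Finset.mem_range] at ht
  split_ifs with h
  · have h1 := P.mean_mem (hD (t + 1) (by omega))
    have h2 := P.mean_mem (hD t (by omega))
    refine (pi_norm_le_iff_of_nonneg zero_le_one).2 fun i => ?_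
    have h3 : 0 ≤ mean (D (t + 1)) i ∧ mean (D (t + 1)) i ≤ 1 := ⟨h1.1 i, h1.2 i⟩
    have h4 : 0 ≤ mean (D t) i ∧ mean (D t) i ≤ 1 := ⟨h2.1 i, h2.2 i⟩
    rw [Pi.sub_apply, Real.norm_eq_abs, abs_le]
    constructor <;> linarith
  · rw [not_not.1 h]
    simp

theorem switchings_le (D : ℕ → Measure (Fin m → ℝ)) {T : ℕ} (hT : 0 < T) :
    switchings D T ≤ T := by
  unfold switchings
  refine (Nat.add_le_add_left (Finset.sum_le_sum (g := fun _ => 1) fun t _ => ?_) 1).trans ?_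
  · split_ifs <;> simp
  · rw [Finset.sum_const, Finset.card_range, smul_eq_mul, mul_one]
    omega

theorem Problem.regret_zero_horizon (P : Problem m 𝕊) (α β : ℝ) (O : Kernel (Fin m → ℝ) 𝕊)
    (D : ℕ → Measure (Fin m → ℝ)) (w : ℕ) : P.regret α β O D 0 w = 0 := by
  simp [Problem.regret]

/-- No arm is ever triggered, so that thresholds above `2 B` cost nothing and remove all charges. -/
theorem Problem.regret_nonpos_of_maxTrig_eq_zero (P : Problem m 𝕊) {B α β : ℝ} (hB : 0 ≤ B)
    {O : Kernel (Fin m → ℝ) 𝕊} {D : ℕ → Measure (Fin m → ℝ)} {T : ℕ}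
    (hP : P.Admissible B α β O D T) {w : ℕ} (hw : 0 < w) (hK : P.maxTrig D T = 0) :
    P.regret α β O D T w ≤ 0 := by
  have h1 := P.regret_le hB hP hw le_rfl (δ := fun _ => 2 * B + 1) (fun _ => by positivity) ?_
  · simpa [hK, excessBound] using h1
  · intro t ht S hgap
    have h2 := P.sum_trigProb_le ht (hP.env t ht) S
    rw [hK, Nat.cast_zero] at h2
    rw [← Finset.sum_mul]
    nlinarith

/-- If all actions are `α`-optimal in all rounds, the drift does not matter. -/
theorem Problem.regret_nonpos_of_gap (P : Problem m 𝕊) {B α β : ℝ}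
    {O : Kernel (Fin m → ℝ) 𝕊} {D : ℕ → Measure (Fin m → ℝ)} {T : ℕ}
    (hP : P.Admissible B α β O D T) (w : ℕ) (h0 : ¬ ∃ t < T, ∃ S, 0 < P.gap α (D t) S) :
    P.regret α β O D T w ≤ 0 := by
  have := hP.oracle.1
  have := P.isProbabilityMeasure_law O T w hP.env
  have hμ := fun t (ht : t < T) => P.mean_mem (hP.env t ht)
  have hr : ∀ t < T, ∀ S, α * P.opt (mean (D t)) ≤ P.r S (mean (D t)) := by
    intro t ht S
    by_contra hlt
    exact h0 ⟨t, ht, S, lt_max_of_lt_right (sub_pos.2 (not_le.1 hlt))⟩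
  have hint : ∑ t : Fin T, α * P.opt (mean (D t))
      ≤ ∫ h, ∑ t : Fin T, P.r (h t).1 (mean (D t)) ∂(P.law O D T w T) := by
    have h1 := integral_mono (μ := P.law O D T w T)
      (integrable_const (∑ t : Fin T, α * P.opt (mean (D t)))) (P.integrable_reward hP w)
      fun h => Finset.sum_le_sum fun t _ => hr t t.2 (h t).1
    simpa using h1
  have h2 : α * β * ∑ t ∈ Finset.range T, P.opt (mean (D t))
      ≤ ∑ t : Fin T, α * P.opt (mean (D t)) := by
    rw [Finset.sum_range, Finset.mul_sum]
    refine Finset.sum_le_sum fun t _ => ?_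
    have h3 := mul_nonneg hP.α_mem.1 (P.opt_nonneg (hP.env t t.2))
    rw [mul_right_comm]
    exact mul_le_of_le_one_right h3 hP.β_mem.2
  rw [Problem.regret]
  linarith

theorem excessBound_nonneg {B L δ : ℝ} (hL : 0 ≤ L) (hδ : 0 < δ) : 0 ≤ excessBound B L δ := by
  unfold excessBound
  split_ifs <;> positivity

theorem excessBound_le {B L δ : ℝ} (hL : 0 ≤ L) (hδ : 0 < δ) :
    excessBound B L δ ≤ 24 * B ^ 2 * (1 + L) / δ := by
  unfold excessBound
  split_ifs
  · positivity
  · gcongr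
    nlinarith [sq_nonneg B]

/-- The window may be tuned with any upper bound `v ≤ T` of the variation. All thresholds are equal;
their value balances the excess against the slack. -/
theorem Problem.regret_windowIndep_le (P : Problem m 𝕊) {B α β : ℝ} (hB : 0 ≤ B)
    {O : Kernel (Fin m → ℝ) 𝕊} {D : ℕ → Measure (Fin m → ℝ)} {T : ℕ}
    (hP : P.Admissible B α β O D T) {v : ℝ} (hv : variation D T ≤ v) (hvT : 0 < T → v ≤ T) :
    P.regret α β O D T (windowIndep m T (P.maxTrig D T) v)
      ≤ (48 * B ^ 2 + 4 * B + 2) * (1 + Real.log T) ^ 1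
        * boundIndep m T (P.maxTrig D T) v := by
  have hv0 := (variation_nonneg D T).trans hv
  have hL := Real.log_natCast_nonneg T
  have hbound : 0 ≤ boundIndep m T (P.maxTrig D T) v := by
    unfold boundIndep
    positivity
  rcases Nat.eq_zero_or_pos T with rfl | hT
  · rw [P.regret_zero_horizon]
    positivity
  replace hvT := hvT hT
  have hT' : (0 : ℝ) < T := by exact_mod_cast hT
  rcases Nat.eq_zero_or_pos (P.maxTrig D T) with hK | hK
  · refine (P.regret_nonpos_of_maxTrig_eq_zero hB hP ?_ hK).trans (by positivity)
    simp [windowIndep, hK, hT]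
  have hKm := P.maxTrig_le D T
  obtain ⟨hw, hwT, h1, h2⟩ := windowIndep_spec hT hK hKm hv0 hvT
  have hsum := fun t (ht : t < T) => P.sum_trigProb_le ht (hP.env t ht)
  set w := windowIndep m T (P.maxTrig D T) v
  have hK' : (0 : ℝ) < (P.maxTrig D T : ℕ) := by exact_mod_cast hK
  have hm' : (0 : ℝ) < m := by exact_mod_cast hK.trans_le hKm
  have hw' : (0 : ℝ) < w := by exact_mod_cast hw
  have hregret := fun ε (hε : 0 < ε) => P.regret_le hB hP hw (e := ε * (P.maxTrig D T : ℕ))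
    (by positivity) (δ := fun _ => ε) (fun _ => hε) (fun t ht S hS => by
      rw [← Finset.sum_mul, mul_comm]
      exact (mul_le_mul_of_nonneg_left (hsum t ht S) hε.le).trans
        (le_add_of_nonneg_left hS.le))
  unfold boundIndep
  set K : ℝ := ((P.maxTrig D T : ℕ) : ℝ)
  set Y := ((m : ℝ) * v) ^ (1 / 3 : ℝ) * (K * T) ^ (2 / 3 : ℝ)
  set L := Real.log T
  have hY : 0 ≤ Y := by positivity
  -- `q` is the common value of the excess term and the slack at the threshold `q / (K T)`
  set q := √(2 * (m * K * T * (T / w))) with hq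
  have hq0 : 0 < q := Real.sqrt_pos.2 (by positivity)
  have hq2 : q ^ 2 = 2 * (m * K * T * (T / w)) := Real.sq_sqrt (by positivity)
  have hqY : q ≤ 2 * (Y + √(m * K * T)) := by
    refine Real.sqrt_le_iff.2 ⟨by positivity, ?_⟩
    have h3 : √(m * K * T) ^ 2 = m * K * T := Real.sq_sqrt (by positivity)
    have h4 : 0 ≤ Y * √(m * K * T) := by positivity
    nlinarith
  have hreg := hregret (q / (K * T)) (by positivity)
  have hblocks : ((T / w + 1 : ℕ) : ℝ) ≤ 2 * (T / w) := by
    push_cast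
    have h3 : ((T / w : ℕ) : ℝ) ≤ T / w := Nat.cast_div_le
    have h4 : (1 : ℝ) ≤ T / w := (one_le_div hw').2 (by exact_mod_cast hwT)
    linarith
  have hexc : ((T / w + 1 : ℕ) : ℝ) * ∑ _i : Fin m, excessBound B L (q / (K * T))
      ≤ 24 * B ^ 2 * (1 + L) * q := by
    rw [Finset.sum_const, Finset.card_univ, Fintype.card_fin, nsmul_eq_mul]
    have h3 : excessBound B L (q / (K * T)) ≤ 24 * B ^ 2 * (1 + L) / (q / (K * T)) :=
      excessBound_le hL (by positivity)
    have h4 : 0 ≤ excessBound B L (q / (K * T)) := excessBound_nonneg hL (by positivity)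
    calc ((T / w + 1 : ℕ) : ℝ) * (m * excessBound B L (q / (K * T)))
        ≤ (2 * (T / w)) * (m * (24 * B ^ 2 * (1 + L) / (q / (K * T)))) := by gcongr
      _ = 24 * B ^ 2 * (1 + L) * (2 * (m * K * T * (T / w))) / q := by field_simp
      _ = 24 * B ^ 2 * (1 + L) * q := by
        rw [← hq2]
        field_simp
  have hslack : q / (K * T) * K * T = q := by field_simp
  rw [hslack] at hreg
  have hdrift : 4 * B * K * w * variation D T ≤ 4 * B * Y := by
    have h3 : K * w * variation D T ≤ K * w * v := by gcongr
    nlinarith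
  have hR : 0 ≤ √(m * K * T) := Real.sqrt_nonneg _
  have hfinal : P.regret α β O D T w
      ≤ (24 * B ^ 2 * (1 + L) + 1) * (2 * (Y + √(m * K * T))) + 4 * B * Y + 4 * B * K * m := by
    have h3 : (24 * B ^ 2 * (1 + L) + 1) * q
        ≤ (24 * B ^ 2 * (1 + L) + 1) * (2 * (Y + √(m * K * T))) := by gcongr
    linarith
  refine hfinal.trans ?_
  rw [pow_one]
  have hL1 : 1 ≤ 1 + L := by linarith
  set R := √(m * K * T)
  have e1 : Y + R ≤ (1 + L) * (Y + R) := le_mul_of_one_le_left (by positivity) hL1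
  have e2 : 4 * B * (Y + K * m) ≤ (1 + L) * (4 * B * (Y + R + m * K)) := by
    refine le_trans ?_ (le_mul_of_one_le_left (by positivity) hL1)
    exact mul_le_mul_of_nonneg_left (by linarith) (by positivity)
  have e3 : 0 ≤ (1 + L) * ((48 * B ^ 2 + 2) * (m * K)) := by positivity
  linarith

/-- The thresholds are `Δ_i / K`: as an action triggers at most `K` arms, its gap pays for them
without slack. -/
theorem Problem.regret_windowDep_le (P : Problem m 𝕊) {B α β : ℝ} (hB : 0 ≤ B)
    {O : Kernel (Fin m → ℝ) 𝕊} {D : ℕ → Measure (Fin m → ℝ)} {T : ℕ}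
    (hP : P.Admissible B α β O D T) {G : ℝ}
    (hG : (∃ t < T, ∃ S, 0 < P.gap α (D t) S) → ∃ i, P.gapMin α D T i ≤ ENNReal.ofReal G)
    {v : ℝ} (hv : variation D T ≤ v) (hvT : 0 < T → v ≤ T) :
    ENNReal.ofReal (P.regret α β O D T (windowDep T v))
      ≤ ENNReal.ofReal ((72 * B ^ 2 + 4 * B * |G| + 4 * B + 1) * (1 + Real.log T) ^ 1)
        * boundDep m T (P.maxTrig D T) v (P.gapMin α D T) := by
  have hv0 := (variation_nonneg D T).trans hv
  have hL := Real.log_natCast_nonneg T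
  rcases Nat.eq_zero_or_pos T with rfl | hT
  · rw [P.regret_zero_horizon]
    simp
  replace hvT := hvT hT
  obtain ⟨hw, h1, h2⟩ := windowDep_spec hT hv0 hvT
  set w := windowDep T v
  rcases Nat.eq_zero_or_pos (P.maxTrig D T) with hK | hK
  · rw [ENNReal.ofReal_of_nonpos (P.regret_nonpos_of_maxTrig_eq_zero hB hP hw hK)]
    exact zero_le
  by_cases hpos : ∃ t < T, ∃ S, 0 < P.gap α (D t) S
  swap
  · rw [ENNReal.ofReal_of_nonpos (P.regret_nonpos_of_gap hP w hpos)]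
    exact zero_le
  have hC : 0 < (72 * B ^ 2 + 4 * B * |G| + 4 * B + 1) * (1 + Real.log T) ^ 1 := by positivity
  have hK' : (0 : ℝ) < (P.maxTrig D T : ℕ) := by exact_mod_cast hK
  have hsum := fun t (ht : t < T) => P.sum_trigProb_le ht (hP.env t ht)
  set Δ := P.gapMin α D T with hΔ
  -- a vanishing minimal gap makes the right-hand side infinite
  by_cases hzero : ∃ i, Δ i = 0
  · obtain ⟨i, hi⟩ := hzero
    have htop : boundDep m T (P.maxTrig D T) v Δ = ⊤ := by
      have : ∑ i, ((P.maxTrig D T : ℕ) : ℝ≥0∞) / Δ i = ⊤ := by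
        refine ENNReal.sum_eq_top.2 ⟨i, Finset.mem_univ _, ?_⟩
        rw [hi, ENNReal.div_zero (by exact_mod_cast hK.ne')]
      rw [boundDep, this]
      simp
    rw [htop, ENNReal.mul_top (by simpa using hC)]
    exact le_top
  push Not at hzero
  obtain ⟨i₀, hi₀⟩ := hG hpos
  set d : Fin m → ℝ := fun i => (Δ i)⁻¹.toReal with hd
  have hd0 : ∀ i, 0 ≤ d i := fun i => ENNReal.toReal_nonneg
  have hdinv : ∀ i, (Δ i)⁻¹ = ENNReal.ofReal (d i) := fun i =>
    (ENNReal.ofReal_toReal (ENNReal.inv_ne_top.2 (hzero i))).symm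
  set δ : Fin m → ℝ := fun i =>
    if Δ i = ⊤ then 2 * B + 1 else (Δ i).toReal / (P.maxTrig D T : ℕ) with hδ
  have hδ0 : ∀ i, 0 < δ i := by
    intro i
    simp only [hδ]
    split_ifs with h
    · positivity
    · exact div_pos (ENNReal.toReal_pos (hzero i) h) hK'
  have hpay : ∀ t < T, ∀ S, 0 < P.gap α (D t) S →
      ∑ i, trigProb P.trig (D t) S i * δ i ≤ P.gap α (D t) S + 0 := by
    intro t ht S hS
    have h3 : ∀ i, trigProb P.trig (D t) S i * δ i
        ≤ trigProb P.trig (D t) S i * (P.gap α (D t) S / (P.maxTrig D T : ℕ)) := by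
      intro i
      rcases (trigProb_nonneg P.trig (D t) S i).eq_or_lt with hp | hp
      · rw [← hp]
        simp
      have hle : Δ i ≤ ENNReal.ofReal (P.gap α (D t) S) :=
        iInf_le_of_le t (iInf_le_of_le ht (iInf_le_of_le S (iInf_le_of_le hp (iInf_le _ hS))))
      have hne : Δ i ≠ ⊤ := ne_top_of_le_ne_top ENNReal.ofReal_ne_top hle
      simp only [hδ, if_neg hne]
      gcongr
      exact ENNReal.toReal_le_of_le_ofReal hS.le hle
    refine (Finset.sum_le_sum fun i _ => h3 i).trans ?_
    rw [← Finset.sum_mul, add_zero, ← mul_div_assoc, div_le_iff₀ hK', mul_comm]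
    exact mul_le_mul_of_nonneg_left (hsum t ht S) hS.le
  have hreg := P.regret_le hB hP hw le_rfl hδ0 hpay
  set K : ℝ := ((P.maxTrig D T : ℕ) : ℝ) with hKdef
  set L := Real.log T
  set a := √(v * T)
  have ha : 0 ≤ a := Real.sqrt_nonneg _
  have hexc : ∀ i, excessBound B L (δ i) ≤ 24 * B ^ 2 * (1 + L) * (K * d i) := by
    intro i
    by_cases h : Δ i = ⊤
    · have h3 : excessBound B L (δ i) = 0 := by
        simp only [hδ, if_pos h, excessBound]
        rw [if_pos (by linarith)]
      rw [h3]
      have := hd0 i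
      positivity
    · refine (excessBound_le hL (hδ0 i)).trans (Eq.le ?_)
      have h3 : δ i = (Δ i).toReal / K := by simp only [hδ, if_neg h]
      simp only [h3, hd, ENNReal.toReal_inv]
      field_simp
  -- the drift term carries no `1 / Δ i`; the arm with `Δ i ≤ G` provides one
  have hgap : 1 ≤ |G| * ∑ i, d i := by
    have hne : Δ i₀ ≠ ⊤ := ne_top_of_le_ne_top ENNReal.ofReal_ne_top hi₀
    have h3 : (Δ i₀).toReal ≤ |G| := ENNReal.toReal_le_of_le_ofReal (abs_nonneg G)
      (hi₀.trans (ENNReal.ofReal_le_ofReal (le_abs_self G)))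
    have h4 : (Δ i₀).toReal * d i₀ = 1 := by
      simp only [hd, ENNReal.toReal_inv]
      exact mul_inv_cancel₀ (ENNReal.toReal_pos (hzero i₀) hne).ne'
    rw [← h4]
    exact mul_le_mul h3 (Finset.single_le_sum (fun i _ => hd0 i) (Finset.mem_univ i₀)) (hd0 i₀)
      (abs_nonneg G)
  have hbound : boundDep m T (P.maxTrig D T) v Δ
      = ENNReal.ofReal (K * a * ∑ i, d i + K * ∑ i, d i + m * K) := by
    have hs : 0 ≤ ∑ i, d i := Finset.sum_nonneg fun i _ => hd0 i
    rw [ENNReal.ofReal_add (by positivity) (by positivity),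
      ENNReal.ofReal_add (by positivity) (by positivity), boundDep, Finset.mul_sum, Finset.mul_sum,
      ENNReal.ofReal_sum_of_nonneg fun i _ => by have := hd0 i; positivity,
      ENNReal.ofReal_sum_of_nonneg fun i _ => by have := hd0 i; positivity]
    congr 1
    · congr 1
      · refine Finset.sum_congr rfl fun i _ => ?_
        rw [div_eq_mul_inv, hdinv, ← ENNReal.ofReal_mul (by positivity)]
      · refine Finset.sum_congr rfl fun i _ => ?_
        rw [div_eq_mul_inv, hdinv, ENNReal.ofReal_mul (by positivity), hKdef,
          ENNReal.ofReal_natCast]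
    · rw [ENNReal.ofReal_mul (by positivity), hKdef, ENNReal.ofReal_natCast,
        ENNReal.ofReal_natCast]
  rw [hbound, ← ENNReal.ofReal_mul hC.le]
  refine ENNReal.ofReal_le_ofReal (hreg.trans ?_)
  set s := ∑ i, d i with hs_def
  have hs : 0 ≤ s := Finset.sum_nonneg fun i _ => hd0 i
  have hblocks : ((T / w + 1 : ℕ) : ℝ) ≤ 3 * (a + 1) := by
    push_cast
    have h3 : ((T / w : ℕ) : ℝ) ≤ T / w := Nat.cast_div_le
    linarith
  have e1 : ((T / w + 1 : ℕ) : ℝ) * ∑ i, excessBound B L (δ i)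
      ≤ 72 * B ^ 2 * (1 + L) * (K * a * s + K * s) := by
    have h3 : ∑ i, excessBound B L (δ i) ≤ 24 * B ^ 2 * (1 + L) * (K * s) := by
      rw [hs_def, Finset.mul_sum, Finset.mul_sum]
      exact Finset.sum_le_sum fun i _ => hexc i
    calc ((T / w + 1 : ℕ) : ℝ) * ∑ i, excessBound B L (δ i)
        ≤ ((T / w + 1 : ℕ) : ℝ) * (24 * B ^ 2 * (1 + L) * (K * s)) := by gcongr
      _ ≤ 3 * (a + 1) * (24 * B ^ 2 * (1 + L) * (K * s)) := by gcongr
      _ = _ := by ring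
  have hL1 : 1 ≤ 1 + L := by linarith
  have e2 : 4 * B * K * w * variation D T ≤ 4 * B * |G| * (1 + L) * (K * a * s) := by
    calc 4 * B * K * w * variation D T ≤ 4 * B * K * w * v := by gcongr
      _ = 4 * B * K * (w * v) := by ring
      _ ≤ 4 * B * K * a := by gcongr
      _ ≤ 4 * B * K * a * (|G| * s) := le_mul_of_one_le_right (by positivity) hgap
      _ ≤ 4 * B * K * a * (|G| * s) * (1 + L) := le_mul_of_one_le_right (by positivity) hL1
      _ = _ := by ring
  have e3 : 4 * B * K * m ≤ 4 * B * (1 + L) * (m * K) := by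
    calc 4 * B * K * m ≤ 4 * B * K * m * (1 + L) := le_mul_of_one_le_right (by positivity) hL1
      _ = _ := by ring
  have e4 : 0 ≤ (1 + L) * ((4 * B * |G| + 4 * B + 1) * (K * s) + (4 * B + 1) * (K * a * s)
      + (72 * B ^ 2 + 4 * B * |G| + 1) * (m * K)) := by positivity
  rw [pow_one]
  linarith

theorem boundIndep_mono (m T K : ℕ) {v v' : ℝ} (hv : 0 ≤ v) (h : v ≤ v') :
    boundIndep m T K v ≤ boundIndep m T K v' := by
  unfold boundIndep
  gcongr

theorem boundDep_mono (m T K : ℕ) {v v' : ℝ} (h : v ≤ v') (Δ : Fin m → ℝ≥0∞) :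
    boundDep m T K v Δ ≤ boundDep m T K v' Δ := by
  unfold boundDep
  gcongr

end Bounds

end CMAB

theorem theorem1 (B : ℝ) (hB : 0 ≤ B) :
    -- the variation is at most the number of switchings
    (∀ (m T : ℕ) (𝕊 : Type*) [MeasurableSpace 𝕊] (P : CMAB.Problem m 𝕊)
        (D : ℕ → MeasureTheory.Measure (Fin m → ℝ)), (∀ t < T, D t ∈ P.envs) →
      CMAB.variation D T ≤ CMAB.switchings D T) ∧
    -- distribution-dependent bound; the constant depends on `B` and on a bound `G` for the
    -- smallest gap
    (∀ G : ℝ, ∃ (C : ℝ) (k : ℕ), 0 ≤ C ∧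
      ∀ (m T : ℕ) (𝕊 : Type*) [MeasurableSpace 𝕊] (P : CMAB.Problem m 𝕊) (α β : ℝ)
        (O : ProbabilityTheory.Kernel (Fin m → ℝ) 𝕊)
        (D : ℕ → MeasureTheory.Measure (Fin m → ℝ)),
        P.Admissible B α β O D T →
        ((∃ t < T, ∃ S, 0 < P.gap α (D t) S) →
          ∃ i, P.gapMin α D T i ≤ ENNReal.ofReal G) →
        ENNReal.ofReal (P.regret α β O D T (CMAB.windowDep T (CMAB.variation D T)))
            ≤ ENNReal.ofReal (C * (1 + Real.log T) ^ k)
              * CMAB.boundDep m T (P.maxTrig D T) (CMAB.variation D T) (P.gapMin α D T) ∧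
        ENNReal.ofReal (P.regret α β O D T (CMAB.windowDep T (CMAB.variation D T)))
            ≤ ENNReal.ofReal (C * (1 + Real.log T) ^ k)
              * CMAB.boundDep m T (P.maxTrig D T) (CMAB.switchings D T) (P.gapMin α D T) ∧
        ENNReal.ofReal (P.regret α β O D T (CMAB.windowDep T (CMAB.switchings D T)))
            ≤ ENNReal.ofReal (C * (1 + Real.log T) ^ k)
              * CMAB.boundDep m T (P.maxTrig D T) (CMAB.switchings D T) (P.gapMin α D T)) ∧
    -- distribution-independent bound; the constant depends on `B` only
    (∃ (C : ℝ) (k : ℕ), 0 ≤ C ∧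
      ∀ (m T : ℕ) (𝕊 : Type*) [MeasurableSpace 𝕊] (P : CMAB.Problem m 𝕊) (α β : ℝ)
        (O : ProbabilityTheory.Kernel (Fin m → ℝ) 𝕊)
        (D : ℕ → MeasureTheory.Measure (Fin m → ℝ)),
        P.Admissible B α β O D T →
        P.regret α β O D T (CMAB.windowIndep m T (P.maxTrig D T) (CMAB.variation D T))
            ≤ C * (1 + Real.log T) ^ k
              * CMAB.boundIndep m T (P.maxTrig D T) (CMAB.variation D T) ∧
        P.regret α β O D T (CMAB.windowIndep m T (P.maxTrig D T) (CMAB.variation D T))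
            ≤ C * (1 + Real.log T) ^ k
              * CMAB.boundIndep m T (P.maxTrig D T) (CMAB.switchings D T) ∧
        P.regret α β O D T (CMAB.windowIndep m T (P.maxTrig D T) (CMAB.switchings D T))
            ≤ C * (1 + Real.log T) ^ k
              * CMAB.boundIndep m T (P.maxTrig D T) (CMAB.switchings D T)) := by
  refine ⟨fun m T 𝕊 _ P D hD => P.variation_le_switchings hD, fun G => ?_, ?_⟩
  · refine ⟨72 * B ^ 2 + 4 * B * |G| + 4 * B + 1, 1, by positivity, ?_⟩
    intro m T 𝕊 _ P α β O D hP hG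
    have hVS := P.variation_le_switchings hP.env
    have hST : 0 < T → (CMAB.switchings D T : ℝ) ≤ T := fun hT => by
      exact_mod_cast CMAB.switchings_le D hT
    have h1 := P.regret_windowDep_le hB hP hG le_rfl fun hT => hVS.trans (hST hT)
    refine ⟨h1, h1.trans ?_, P.regret_windowDep_le hB hP hG hVS hST⟩
    gcongr
    exact CMAB.boundDep_mono _ _ _ hVS _
  · refine ⟨48 * B ^ 2 + 4 * B + 2, 1, by positivity, ?_⟩
    intro m T 𝕊 _ P α β O D hP
    have hVS := P.variation_le_switchings hP.env
    have hST : 0 < T → (CMAB.switchings D T : ℝ) ≤ T := fun hT => by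
      exact_mod_cast CMAB.switchings_le D hT
    have h1 := P.regret_windowIndep_le hB hP le_rfl fun hT => hVS.trans (hST hT)
    refine ⟨h1, h1.trans ?_, P.regret_windowIndep_le hB hP hVS hST⟩
    have hL := Real.log_natCast_nonneg T
    exact mul_le_mul_of_nonneg_left
      (CMAB.boundIndep_mono _ _ _ (CMAB.variation_nonneg D T) hVS) (by positivity)
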